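/- Let $q\in\mathbb C\setminus\{0,\pm1,\pm i\}$ and let $\mathcal A=\mathrm{Fun}_q(\mathrm{GL}(3,\mathbb C))$ be the unital algebra generated by $z^i{}_j$ ($i,j=1,2,3$) and $\mathcal D^{-1}$, with relations $z^i{}_jz^i{}_k=q\,z^i{}_kz^i{}_j$ ($j<k$), $z^i{}_jz^k{}_j=q\,z^k{}_jz^i{}_j$ ($i<k$), $z^i{}_jz^k{}_l=z^k{}_lz^i{}_j$ ($i<k,\ j>l$), $z^i{}_jz^k{}_l=z^k{}_lz^i{}_j+(q-q^{-1})z^k{}_jz^i{}_l$ ($i<k,\ j<l$), and $\mathcal D\mathcal D^{-1}=\mathcal D^{-1}\mathcal D=\mathbf 1$, where $\mathcal D=z^1{}_1z^2{}_2z^3{}_3+q^2z^1{}_2z^2{}_3z^3{}_1+q^2z^1{}_3z^2{}_1z^3{}_2-q\,z^1{}_1z^2{}_3z^3{}_2-q^3z^1{}_3z^2{}_2z^3{}_1-q\,z^1{}_2z^2{}_1z^3{}_3$. It is a Hopf algebra with $\Delta(z^i{}_j)=\sum_kz^i{}_k\otimes z^k{}_j$ and antipode $S$. A first order differential calculus on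 $\mathcal A$ is an $\mathcal A$-bimodule $\Gamma$ with a linear map $\mathrm d:\mathcal A\to\Gamma$ such that $\mathrm d(ab)=(\mathrm da)b+a\,\mathrm db$ and $\mathrm d\mathcal A$ generates $\Gamma$ as a left module. It is bicovariant if there are linear maps $\Delta_L:\Gamma\to\mathcal A\otimes\Gamma$ and $\Delta_R:\Gamma\to\Gamma\otimes\mathcal A$ with $\Delta_L(a\,\mathrm db)=\Delta(a)(\mathrm{id}\otimes\mathrm d)\Delta(b)$ and $\Delta_R(a\,\mathrm db)=\Delta(a)(\mathrm d\otimes\mathrm{id})\Delta(b)$. Two calculi are equivalent if some bimodule isomorphism intertwines their differentials. Put $\theta^i{}_j=\sum_kS(z^i{}_k)\,\mathrm dz^k{}_j$ and $\mathrm{Tr}_q\theta=q^4\theta^1{}_1+q^2\theta^2{}_2+\theta^3{}_3$. With $e_i{}^j$ the matrix units and $R=\sum_{i,j}q^{\delta_{ij}}e_i{}^i\otimes e_j{}^j+(q-q^{-1})\sum_{i>j}e_i{}^j\otimes e_j{}^i$, whose entries are written $R^i{}_j{}^k{}_l$ (first tensor factor in row $i$, column $j$; second in row $k$, column $l$), the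 calculi $\Gamma_\nu(t)$ ($\nu=1,2$) are those for which $\Gamma$ is a free left module with a basis $\omega_i{}^j$, with right multiplication (repeated indices summed) $$\nu=1:\ \ \omega_i{}^jz^k{}_l=t\,z^k{}_d\,(R^{-1})^d{}_e{}^a{}_i\,(R^{-1})^j{}_b{}^e{}_l\,\omega_a{}^b,\qquad \nu=2:\ \ \omega_i{}^jz^k{}_l=t\,z^k{}_d\,R^a{}_i{}^d{}_e\,R^e{}_l{}^j{}_b\,\omega_a{}^b,$$ and $\mathrm da=\frac1{q-q^{-1}}\bigl[\sum_i\omega_i{}^i,a\bigr]$ for all $a\in\mathcal A$. Let $t\in\mathbb C\setminus\{0\}$, with $(q^6+q^4+1)t-(q^6+q^4+q^2)\ne0$ if $\nu=1$ and $(q^6+q^2+1)t-(q^4+q^2+1)\neq0$ if $\nu=2$. Then $\Gamma_\nu(t)$ exists, is unique up to equivalence, and is bicovariant. Moreover a first order differential calculus on $\mathcal A$ is a $\Gamma_\nu(t)$ if and only if the $\mathrm dz^i{}_j$ form a left-module basis of $\Gamma$ and the following relations hold for all indices in the indicated ranges. For $\nu=1$, with $N=q^4(q^2+1)(t-1)-q^2+t$,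 $\sigma=\frac{(q^2-t)(t-1)}{N}$ and $\beta=\frac{t(q^2-1)(t-1)}{N}$: * $(\mathrm dz^i{}_j)z^i{}_j=(\tfrac t{q^2}+t-1)z^i{}_j\,\mathrm dz^i{}_j+\sigma z^i{}_jz^i{}_j\mathrm{Tr}_q\theta$; * $(\mathrm dz^i{}_j)z^i{}_l=\tfrac tq z^i{}_l\,\mathrm dz^i{}_j+(t-1)z^i{}_j\,\mathrm dz^i{}_l+\sigma z^i{}_jz^i{}_l\mathrm{Tr}_q\theta$ for $j<l$; * $(\mathrm dz^i{}_j)z^k{}_j=\tfrac tq z^k{}_j\,\mathrm dz^i{}_j+(t-1)z^i{}_j\,\mathrm dz^k{}_j+\sigma z^i{}_jz^k{}_j\mathrm{Tr}_q\theta$ for $i<k$; * $(\mathrm dz^i{}_j)z^k{}_l=t z^k{}_l\,\mathrm dz^i{}_j+(t-1)z^i{}_j\,\mathrm dz^k{}_l+\sigma z^i{}_jz^k{}_l\mathrm{Tr}_q\theta-\beta(z^i{}_jz^k{}_l-q z^i{}_lz^k{}_j)\mathrm{Tr}_q\theta$ for $i<k$, $j<l$; * $(\mathrm dz^i{}_j)z^k{}_l=t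 z^k{}_l\,\mathrm dz^i{}_j+(t-1)z^i{}_j\,\mathrm dz^k{}_l+\sigma z^i{}_jz^k{}_l\mathrm{Tr}_q\theta-t(q-\tfrac1q)z^k{}_j\,\mathrm dz^i{}_l+q\beta(z^i{}_lz^k{}_j-q z^i{}_jz^k{}_l)\mathrm{Tr}_q\theta$ for $i<k$, $j>l$. For $\nu=2$, with $\hat N=q^4(q^2t-1)+(q^2+1)(t-1)$, $\hat\sigma=-\frac{(q^2t-1)(t-1)}{\hat N}$ and $\hat\beta=-\frac{t(q^2-1)(t-1)}{\hat N}$: * $(\mathrm dz^i{}_j)z^i{}_j=(tq^2+t-1)z^i{}_j\,\mathrm dz^i{}_j+\hat\sigma z^i{}_jz^i{}_j\mathrm{Tr}_q\theta$; * $(\mathrm dz^i{}_j)z^i{}_l=tq z^i{}_l\,\mathrm dz^i{}_j+(tq^2-1)z^i{}_j\,\mathrm dz^i{}_l+\hat\sigma z^i{}_jz^i{}_l\mathrm{Tr}_q\theta$ for $j<l$; * $(\mathrm dz^i{}_j)z^k{}_j=tq z^k{}_j\,\mathrm dz^i{}_j+(tq^2-1)z^i{}_j\,\mathrm dz^k{}_j+\hat\sigma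 z^i{}_jz^k{}_j\mathrm{Tr}_q\theta$ for $i<k$; * $(\mathrm dz^i{}_j)z^k{}_l=t z^k{}_l\,\mathrm dz^i{}_j+(t-1)z^i{}_j\,\mathrm dz^k{}_l+\hat\sigma z^i{}_jz^k{}_l\mathrm{Tr}_q\theta+t(q-\tfrac1q)(z^i{}_l\,\mathrm dz^k{}_j+z^k{}_j\,\mathrm dz^i{}_l)+t(q-\tfrac1q)^2z^i{}_j\,\mathrm dz^k{}_l-\tfrac1{q^2}\hat\beta(z^i{}_jz^k{}_l-q z^i{}_lz^k{}_j)\mathrm{Tr}_q\theta$ for $i<k$, $j<l$; * $(\mathrm dz^i{}_j)z^k{}_l=t z^k{}_l\,\mathrm dz^i{}_j+(t-1)z^i{}_j\,\mathrm dz^k{}_l+\hat\sigma z^i{}_jz^k{}_l\mathrm{Tr}_q\theta+t(q-\tfrac1q)z^i{}_l\,\mathrm dz^k{}_j+\tfrac1q\hat\beta(z^i{}_lz^k{}_j-q z^i{}_jz^k{}_l)\mathrm{Tr}_q\theta$ for $i<k$, $j>l$. Finally, these relations imply the missing ones: for each $\nu$ and $t$ as above there are $c^{ik}_{jl;mn}\in\mathcal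 A$ such that in every first order differential calculus on $\mathcal A$ satisfying the relations, $(\mathrm dz^i{}_j)z^k{}_l=\sum_{m,n}c^{ik}_{jl;mn}\,\mathrm dz^m{}_n$ for all $i,j,k,l$. -/

import Mathlib

open scoped TensorProduct Kronecker RightActions

/-- Generators of `Fun_q(GL(3,ℂ))`: the entries `z i j` of the quantum matrix and the inverse of the
quantum determinant.  Indices run through `0, 1, 2` instead of `1, 2, 3`. -/
inductive GLqGen : Type
  | z (i j : Fin 3)
  | detInv

/-- The quantum determinant of a `3 × 3` array of elements of an algebra. -/
def qdet {B : Type*} [Ring B] [Algebra ℂ B] (q : ℂ) (x : Fin 3 → Fin 3 → B) : B :=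
  x 0 0 * x 1 1 * x 2 2 + q ^ 2 • (x 0 1 * x 1 2 * x 2 0) + q ^ 2 • (x 0 2 * x 1 0 * x 2 1)
    - q • (x 0 0 * x 1 2 * x 2 1) - q ^ 3 • (x 0 2 * x 1 1 * x 2 0) - q • (x 0 1 * x 1 0 * x 2 2)

/-- The defining relations of `Fun_q(GL(3,ℂ))`. -/
inductive GLqRel (q : ℂ) : FreeAlgebra ℂ GLqGen → FreeAlgebra ℂ GLqGen → Prop
  | row (i j k : Fin 3) (h : j < k) :
      GLqRel q (FreeAlgebra.ι ℂ (.z i j) * FreeAlgebra.ι ℂ (.z i k))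
        (q • (FreeAlgebra.ι ℂ (.z i k) * FreeAlgebra.ι ℂ (.z i j)))
  | col (i k j : Fin 3) (h : i < k) :
      GLqRel q (FreeAlgebra.ι ℂ (.z i j) * FreeAlgebra.ι ℂ (.z k j))
        (q • (FreeAlgebra.ι ℂ (.z k j) * FreeAlgebra.ι ℂ (.z i j)))
  | comm (i j k l : Fin 3) (h : i < k) (h' : l < j) :
      GLqRel q (FreeAlgebra.ι ℂ (.z i j) * FreeAlgebra.ι ℂ (.z k l))
        (FreeAlgebra.ι ℂ (.z k l) * FreeAlgebra.ι ℂ (.z i j))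
  | cross (i j k l : Fin 3) (h : i < k) (h' : j < l) :
      GLqRel q (FreeAlgebra.ι ℂ (.z i j) * FreeAlgebra.ι ℂ (.z k l))
        (FreeAlgebra.ι ℂ (.z k l) * FreeAlgebra.ι ℂ (.z i j)
          + (q - q⁻¹) • (FreeAlgebra.ι ℂ (.z k j) * FreeAlgebra.ι ℂ (.z i l)))
  | det_mul_detInv :
      GLqRel q (qdet q (fun i j => FreeAlgebra.ι ℂ (.z i j)) * FreeAlgebra.ι ℂ .detInv) 1
  | detInv_mul_det :
      GLqRel q (FreeAlgebra.ι ℂ .detInv * qdet q (fun i j => FreeAlgebra.ι ℂ (.z i j))) 1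

/-- The algebra `Fun_q(GL(3,ℂ))`. -/
def GLq (q : ℂ) : Type := RingQuot (GLqRel q)

noncomputable section

instance (q : ℂ) : Ring (GLq q) := inferInstanceAs (Ring (RingQuot (GLqRel q)))

instance (q : ℂ) : Algebra ℂ (GLq q) := inferInstanceAs (Algebra ℂ (RingQuot (GLqRel q)))

namespace GLq

/-- The generator `z^i_j`. -/
def z (q : ℂ) (i j : Fin 3) : GLq q :=
  RingQuot.mkAlgHom ℂ (GLqRel q) (FreeAlgebra.ι ℂ (.z i j))

/-- The generator `𝒟⁻¹`. -/
def detInv (q : ℂ) : GLq q := RingQuot.mkAlgHom ℂ (GLqRel q) (FreeAlgebra.ι ℂ .detInv)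

theorem map_qdet {B C : Type*} [Ring B] [Algebra ℂ B] [Ring C] [Algebra ℂ C] (f : B →ₐ[ℂ] C)
    (q : ℂ) (x : Fin 3 → Fin 3 → B) : f (qdet q x) = qdet q (fun i j => f (x i j)) := by
  simp [qdet]

theorem z_row (q : ℂ) (i j k : Fin 3) (h : j < k) : z q i j * z q i k = q • (z q i k * z q i j) := by
  have := RingQuot.mkAlgHom_rel ℂ (GLqRel.row (q := q) i j k h)
  simp only [map_mul, map_smul] at this
  exact this

theorem z_col (q : ℂ) (i k j : Fin 3) (h : i < k) : z q i j * z q k j = q • (z q k j * z q i j) := by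
  have := RingQuot.mkAlgHom_rel ℂ (GLqRel.col (q := q) i k j h)
  simp only [map_mul, map_smul] at this
  exact this

theorem z_comm (q : ℂ) (i j k l : Fin 3) (h : i < k) (h' : l < j) :
    z q i j * z q k l = z q k l * z q i j := by
  have := RingQuot.mkAlgHom_rel ℂ (GLqRel.comm (q := q) i j k l h h')
  simp only [map_mul] at this
  exact this

theorem z_cross (q : ℂ) (i j k l : Fin 3) (h : i < k) (h' : j < l) :
    z q i j * z q k l = z q k l * z q i j + (q - q⁻¹) • (z q k j * z q i l) := by
  have := RingQuot.mkAlgHom_rel ℂ (GLqRel.cross (q := q) i j k l h h')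
  simp only [map_mul, map_add, map_smul] at this
  exact this

theorem qdet_mul_detInv (q : ℂ) : qdet q (z q) * detInv q = 1 := by
  have := RingQuot.mkAlgHom_rel ℂ (GLqRel.det_mul_detInv (q := q))
  rw [map_mul, map_qdet, map_one] at this
  exact this

theorem detInv_mul_qdet (q : ℂ) : detInv q * qdet q (z q) = 1 := by
  have := RingQuot.mkAlgHom_rel ℂ (GLqRel.detInv_mul_det (q := q))
  rw [map_mul, map_qdet, map_one] at this
  exact this

/-- The prescribed value of the coproduct on `z^i_j`. -/
def comulZ (q : ℂ) (i j : Fin 3) : GLq q ⊗[ℂ] GLq q := ∑ a, z q i a ⊗ₜ[ℂ] z q a j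

theorem z_comm' (q : ℂ) (i j k l : Fin 3) (h : i < k) (h' : l < j) :
    z q k l * z q i j = (1 : ℂ) • (z q i j * z q k l) := by
  rw [one_smul, z_comm q i j k l h h']

theorem z_cross' (q : ℂ) (i j k l : Fin 3) (h : i < k) (h' : j < l) :
    z q k l * z q i j = z q i j * z q k l - (q - q⁻¹) • (z q i l * z q k j) := by
  rw [z_cross q i j k l h h', z_comm q i l k j h h', add_sub_cancel_right]


section relations

variable (q : ℂ) [NeZero q]

theorem z_row' (i j k : Fin 3) (h : j < k) : z q i k * z q i j = q⁻¹ • (z q i j * z q i k) := by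
  rw [z_row q i j k h, smul_smul, inv_mul_cancel₀ (NeZero.ne q), one_smul]

theorem z_col' (i k j : Fin 3) (h : i < k) : z q k j * z q i j = q⁻¹ • (z q i j * z q k j) := by
  rw [z_col q i k j h, smul_smul, inv_mul_cancel₀ (NeZero.ne q), one_smul]

theorem comulZ_row (i j k : Fin 3) (h : j < k) :
    comulZ q i j * comulZ q i k = q • (comulZ q i k * comulZ q i j) := by
  have hq : q ≠ 0 := NeZero.ne q
  fin_cases j <;> fin_cases k <;> (try (exact absurd h (by decide))) <;> clear h <;>
  simp only [Fin.zero_eta, Fin.mk_one, Fin.reduceFinMk, comulZ, Fin.sum_univ_three, add_mul,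
    mul_add, Algebra.TensorProduct.tmul_mul_tmul] <;>
  simp (disch := decide) only [z_row', z_comm', z_cross', TensorProduct.tmul_sub,
    ← TensorProduct.smul_tmul', TensorProduct.tmul_smul] <;>
  match_scalars <;> field_simp <;> ring

theorem comulZ_col (i k j : Fin 3) (h : i < k) :
    comulZ q i j * comulZ q k j = q • (comulZ q k j * comulZ q i j) := by
  have hq : q ≠ 0 := NeZero.ne q
  fin_cases i <;> fin_cases k <;> (try (exact absurd h (by decide))) <;> clear h <;>
  simp only [Fin.zero_eta, Fin.mk_one, Fin.reduceFinMk, comulZ, Fin.sum_univ_three, add_mul,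
    mul_add, Algebra.TensorProduct.tmul_mul_tmul] <;>
  simp (disch := decide) only [z_col', z_comm', z_cross',
    TensorProduct.sub_tmul, ← TensorProduct.smul_tmul', TensorProduct.tmul_smul] <;>
  match_scalars <;> field_simp <;> ring

theorem comulZ_comm (i j k l : Fin 3) (h : i < k) (h' : l < j) :
    comulZ q i j * comulZ q k l = comulZ q k l * comulZ q i j := by
  have hq : q ≠ 0 := NeZero.ne q
  fin_cases i <;> fin_cases k <;> (try (exact absurd h (by decide))) <;> clear h <;>
  fin_cases l <;> fin_cases j <;> (try (exact absurd h' (by decide))) <;> clear h' <;>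
  simp only [Fin.zero_eta, Fin.mk_one, Fin.reduceFinMk, comulZ, Fin.sum_univ_three, add_mul,
    mul_add, Algebra.TensorProduct.tmul_mul_tmul] <;>
  simp (disch := decide) only [z_row', z_col', z_comm', z_cross', TensorProduct.tmul_sub,
    TensorProduct.sub_tmul, ← TensorProduct.smul_tmul', TensorProduct.tmul_smul] <;>
  match_scalars <;> field_simp

theorem comulZ_cross (i j k l : Fin 3) (h : i < k) (h' : j < l) :
    comulZ q i j * comulZ q k l = comulZ q k l * comulZ q i j
      + (q - q⁻¹) • (comulZ q k j * comulZ q i l) := by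
  have hq : q ≠ 0 := NeZero.ne q
  fin_cases i <;> fin_cases k <;> (try (exact absurd h (by decide))) <;> clear h <;>
  fin_cases j <;> fin_cases l <;> (try (exact absurd h' (by decide))) <;> clear h' <;>
  simp only [Fin.zero_eta, Fin.mk_one, Fin.reduceFinMk, comulZ, Fin.sum_univ_three, add_mul,
    mul_add, Algebra.TensorProduct.tmul_mul_tmul] <;>
  simp (disch := decide) only [z_row', z_col', z_comm', z_cross', TensorProduct.tmul_sub,
    TensorProduct.sub_tmul, ← TensorProduct.smul_tmul', TensorProduct.tmul_smul] <;>
  match_scalars <;> field_simp <;> ring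

/-- `z^a_i z^b_j z^c_k` summed over `i, j, k` against the `q`-antisymmetric symbol. -/
def eps (a b c : Fin 3) : GLq q :=
  z q a 0 * z q b 1 * z q c 2 + q ^ 2 • (z q a 1 * z q b 2 * z q c 0)
    + q ^ 2 • (z q a 2 * z q b 0 * z q c 1) - q • (z q a 0 * z q b 2 * z q c 1)
    - q ^ 3 • (z q a 2 * z q b 1 * z q c 0) - q • (z q a 1 * z q b 0 * z q c 2)

theorem eps_left (a c : Fin 3) : eps q a a c = 0 := by
  have hq : q ≠ 0 := NeZero.ne q
  simp (disch := decide) only [eps, z_row', smul_mul_assoc]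
  match_scalars <;> field_simp <;> ring

theorem eps_right (a b : Fin 3) : eps q a b b = 0 := by
  have hq : q ≠ 0 := NeZero.ne q
  simp (disch := decide) only [eps, mul_assoc, z_row', mul_smul_comm]
  match_scalars <;> field_simp <;> ring

theorem eps_swap_left (a b c : Fin 3) (h : a < b) : eps q b a c = -q • eps q a b c := by
  have hq : q ≠ 0 := NeZero.ne q
  have h1 := fun j l => z_cross' q a j b l h
  have h2 := fun j l => z_comm' q a j b l h
  simp (disch := decide) only [eps, h1, h2, sub_mul, smul_mul_assoc]
  match_scalars <;> field_simp <;> ring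

theorem eps_swap_right (a b c : Fin 3) (h : b < c) : eps q a c b = -q • eps q a b c := by
  have hq : q ≠ 0 := NeZero.ne q
  have h1 := fun j l => z_cross' q b j c l h
  have h2 := fun j l => z_comm' q b j c l h
  simp (disch := decide) only [eps, mul_assoc, h1, h2, mul_sub, mul_smul_comm]
  match_scalars <;> field_simp <;> ring

theorem qdet_comulZ : qdet q (comulZ q) = qdet q (z q) ⊗ₜ[ℂ] qdet q (z q) := by
  have key : qdet q (comulZ q) =
      ∑ c, ∑ b, ∑ a, (z q 0 a * z q 1 b * z q 2 c) ⊗ₜ[ℂ] eps q a b c := by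
    simp only [qdet, comulZ, eps, TensorProduct.tmul_add, TensorProduct.tmul_sub,
      TensorProduct.tmul_smul, Finset.sum_add_distrib, Finset.sum_sub_distrib, ← Finset.smul_sum,
      Finset.sum_mul, Finset.mul_sum, Algebra.TensorProduct.tmul_mul_tmul]
  have e : eps q 0 1 2 = qdet q (z q) := rfl
  have e021 : eps q 0 2 1 = -q • qdet q (z q) := by rw [eps_swap_right q 0 1 2 (by decide), e]
  have e102 : eps q 1 0 2 = -q • qdet q (z q) := by rw [eps_swap_left q 0 1 2 (by decide), e]
  have e120 : eps q 1 2 0 = q ^ 2 • qdet q (z q) := by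
    rw [eps_swap_right q 1 0 2 (by decide), e102]; module
  have e201 : eps q 2 0 1 = q ^ 2 • qdet q (z q) := by
    rw [eps_swap_left q 0 2 1 (by decide), e021]; module
  have e210 : eps q 2 1 0 = -q ^ 3 • qdet q (z q) := by
    rw [eps_swap_left q 1 2 0 (by decide), e120]; module
  have m1 (a b : Fin 3) (h : a < b) : eps q b a b = 0 := by
    rw [eps_swap_left q a b b h, eps_right, smul_zero]
  have m2 (a b : Fin 3) (h : a < b) : eps q a b a = 0 := by
    have := eps_swap_left q a b a h
    have h0 : eps q b a a = 0 := eps_right q b a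
    rw [h0] at this
    exact (smul_eq_zero.1 this.symm).resolve_left (neg_ne_zero.2 (NeZero.ne q))
  rw [key]
  simp (disch := decide) only [Fin.sum_univ_three, eps_left, eps_right, m1, m2, e, e021, e102,
    e120, e201, e210, TensorProduct.tmul_zero, add_zero, zero_add, TensorProduct.tmul_smul]
  conv_rhs => lhs; rw [qdet]
  simp only [TensorProduct.add_tmul, TensorProduct.sub_tmul, ← TensorProduct.smul_tmul']
  module

/-- The coproduct `Δ`, the algebra homomorphism with `Δ(z^i_j) = z^i_a ⊗ z^a_j` and
`Δ(𝒟⁻¹) = 𝒟⁻¹ ⊗ 𝒟⁻¹`. -/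
def comul : GLq q →ₐ[ℂ] GLq q ⊗[ℂ] GLq q :=
  RingQuot.liftAlgHom ℂ ⟨FreeAlgebra.lift ℂ fun g => match g with
    | .z i j => comulZ q i j
    | .detInv => detInv q ⊗ₜ[ℂ] detInv q, by
      intro x y h
      cases h with
      | row i j k h => simpa using comulZ_row q i j k h
      | col i k j h => simpa using comulZ_col q i k j h
      | comm i j k l h h' => simpa using comulZ_comm q i j k l h h'
      | cross i j k l h h' => simpa using comulZ_cross q i j k l h h'
      | det_mul_detInv =>
        rw [map_mul, map_qdet, map_one]
        simp only [FreeAlgebra.lift_ι_apply]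
        change qdet q (comulZ q) * _ = _
        rw [qdet_comulZ, Algebra.TensorProduct.tmul_mul_tmul, qdet_mul_detInv]; rfl
      | detInv_mul_det =>
        rw [map_mul, map_qdet, map_one]
        simp only [FreeAlgebra.lift_ι_apply]
        change _ * qdet q (comulZ q) = _
        rw [qdet_comulZ, Algebra.TensorProduct.tmul_mul_tmul, detInv_mul_qdet]; rfl⟩

theorem comul_z (i j : Fin 3) : comul q (z q i j) = ∑ a, z q i a ⊗ₜ[ℂ] z q a j := by
  simp only [comul, z]
  erw [RingQuot.liftAlgHom_mkAlgHom_apply]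
  simp [comulZ, z]

theorem comul_detInv : comul q (detInv q) = detInv q ⊗ₜ[ℂ] detInv q := by
  simp only [comul, detInv]
  erw [RingQuot.liftAlgHom_mkAlgHom_apply]
  simp

end relations

/-- The matrix `S(Z)` of the values of the antipode, `antipodeZ q i j = S(z^i_j)`. -/
def antipodeZ (q : ℂ) (i j : Fin 3) : GLq q :=
  detInv q * (!![
    z q 1 1 * z q 2 2 - q • (z q 1 2 * z q 2 1),
    -q⁻¹ • (z q 0 1 * z q 2 2) + z q 0 2 * z q 2 1,
    q⁻¹ ^ 2 • (z q 0 1 * z q 1 2) - q⁻¹ • (z q 0 2 * z q 1 1);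
    -q • (z q 1 0 * z q 2 2) + q ^ 2 • (z q 1 2 * z q 2 0),
    z q 0 0 * z q 2 2 - q • (z q 0 2 * z q 2 0),
    -q⁻¹ • (z q 0 0 * z q 1 2) + z q 0 2 * z q 1 0;
    q ^ 2 • (z q 1 0 * z q 2 1) - q ^ 3 • (z q 1 1 * z q 2 0),
    -q • (z q 0 0 * z q 2 1) + q ^ 2 • (z q 0 1 * z q 2 0),
    z q 0 0 * z q 1 1 - q • (z q 0 1 * z q 1 0)] i j)

/-- The `R`-matrix.  The entry `R^i_j^k_l` (first tensor factor `i, j`, second `k, l`) is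
`Rmat q (i, k) (j, l)`. -/
def Rmat (q : ℂ) : Matrix (Fin 3 × Fin 3) (Fin 3 × Fin 3) ℂ :=
  (∑ i : Fin 3, ∑ j : Fin 3,
      (if i = j then q else 1) • (Matrix.single i i (1 : ℂ) ⊗ₖ Matrix.single j j (1 : ℂ)))
    + (q - q⁻¹) • ∑ i : Fin 3, ∑ j : Fin 3,
        if j < i then Matrix.single i j (1 : ℂ) ⊗ₖ Matrix.single j i (1 : ℂ) else 0

end GLq

/-- A first order differential calculus over an associative unital complex algebra `A`: an
`A`-bimodule `Form` with a linear map `d` satisfying the Leibniz rule, such that `d A` generates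
`Form` as a left module.  `a • ρ` is the left action and `ρ <• a` the right action.  (`Form` is a
quotient of `A ⊗ A`, so `Type` is no restriction for `A : Type`.) -/
structure FirstOrderCalculus (A : Type) [Ring A] [Algebra ℂ A] where
  Form : Type
  [addCommGroup : AddCommGroup Form]
  [complexModule : Module ℂ Form]
  [leftModule : Module A Form]
  [rightModule : Module Aᵐᵒᵖ Form]
  [bimodule : SMulCommClass A Aᵐᵒᵖ Form]
  [leftTower : IsScalarTower ℂ A Form]
  [rightTower : IsScalarTower ℂ Aᵐᵒᵖ Form]
  d : A →ₗ[ℂ] Form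
  leibniz : ∀ a b : A, d (a * b) = d a <• b + a • d b
  span_range_d : Submodule.span A (Set.range d) = ⊤

namespace FirstOrderCalculus

attribute [instance] addCommGroup complexModule leftModule rightModule bimodule leftTower rightTower

section general
variable {A : Type} [Ring A] [Algebra ℂ A]

/-- Equivalence of calculi: a bimodule isomorphism intertwining the differentials. -/
def Equivalent (C C' : FirstOrderCalculus A) : Prop :=
  ∃ ζ : C.Form ≃ₗ[A] C'.Form,
    (∀ (ρ : C.Form) (a : A), ζ (ρ <• a) = ζ ρ <• a) ∧ ∀ a : A, ζ (C.d a) = C'.d a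

/-- Left multiplication on `Form` as a linear map. -/
def lsmul (C : FirstOrderCalculus A) : A →ₗ[ℂ] C.Form →ₗ[ℂ] C.Form :=
  (Algebra.lsmul ℂ ℂ C.Form).toLinearMap

/-- The left action of `A ⊗ A` on `A ⊗ Form`, `(a ⊗ b) (c ⊗ ρ) = a c ⊗ b ρ`. -/
def actL (C : FirstOrderCalculus A) : A ⊗[ℂ] A →ₗ[ℂ] A ⊗[ℂ] C.Form →ₗ[ℂ] A ⊗[ℂ] C.Form :=
  TensorProduct.map₂ (LinearMap.mul ℂ A) C.lsmul

/-- The left action of `A ⊗ A` on `Form ⊗ A`, `(a ⊗ b) (ρ ⊗ c) = a ρ ⊗ b c`. -/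
def actR (C : FirstOrderCalculus A) : A ⊗[ℂ] A →ₗ[ℂ] C.Form ⊗[ℂ] A →ₗ[ℂ] C.Form ⊗[ℂ] A :=
  TensorProduct.map₂ C.lsmul (LinearMap.mul ℂ A)

/-- A family of 1-forms indexed by two indices is a basis of `Form` as a left `A`-module. -/
def IsLeftBasis (C : FirstOrderCalculus A) (ω : Fin 3 → Fin 3 → C.Form) : Prop :=
  LinearIndependent A (fun p : Fin 3 × Fin 3 => ω p.1 p.2) ∧
    Submodule.span A (Set.range fun p : Fin 3 × Fin 3 => ω p.1 p.2) = ⊤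

end general

section GLq
variable {q : ℂ}

/-- Bicovariance of a calculus on `GL_q(3,ℂ)`: existence of the left and right coactions
`Δ_L (a d b) = Δ(a) (id ⊗ d) Δ(b)` and `Δ_R (a d b) = Δ(a) (d ⊗ id) Δ(b)`. -/
def IsBicovariant [NeZero q] (C : FirstOrderCalculus (GLq q)) : Prop :=
  (∃ ΔL : C.Form →ₗ[ℂ] GLq q ⊗[ℂ] C.Form, ∀ a b : GLq q,
    ΔL (a • C.d b) = C.actL (GLq.comul q a) (TensorProduct.map LinearMap.id C.d (GLq.comul q b))) ∧
  (∃ ΔR : C.Form →ₗ[ℂ] C.Form ⊗[ℂ] GLq q, ∀ a b : GLq q,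
    ΔR (a • C.d b) = C.actR (GLq.comul q a) (TensorProduct.map C.d LinearMap.id (GLq.comul q b)))

/-- The differential `d z^i_j`. -/
def dz (C : FirstOrderCalculus (GLq q)) (i j : Fin 3) : C.Form := C.d (GLq.z q i j)

/-- The Maurer-Cartan form `θ^i_j = S(z^i_k) d z^k_j`. -/
def theta (C : FirstOrderCalculus (GLq q)) (i j : Fin 3) : C.Form :=
  ∑ k, GLq.antipodeZ q i k • C.dz k j

/-- `Tr_q θ = q⁴ θ^1_1 + q² θ^2_2 + θ^3_3`. -/
def trTheta (C : FirstOrderCalculus (GLq q)) : C.Form :=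
  q ^ 4 • C.theta 0 0 + q ^ 2 • C.theta 1 1 + C.theta 2 2

/-- The inner derivation `d a = (q - q⁻¹)⁻¹ [Tr ω, a]`, where `Tr ω = ∑ ω_i^i`. -/
def IsInnerBy (C : FirstOrderCalculus (GLq q)) (ω : Fin 3 → Fin 3 → C.Form) : Prop :=
  ∀ a : GLq q, C.d a = (q - q⁻¹)⁻¹ • ((∑ i, ω i i) <• a - a • ∑ i, ω i i)

/-- `C` is (a copy of) the calculus `Γ₁(t)`: the free left module on `ω_i^j` (written `ω i j`) with
right multiplication
`ω_i^j z^k_l = t z^k_d (R⁻¹)^d_e^a_i (R⁻¹)^j_b^e_l ω_a^b` and `d = (q - q⁻¹)⁻¹ [Tr ω, ·]`. -/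
def IsGamma1 (C : FirstOrderCalculus (GLq q)) (t : ℂ) : Prop :=
  ∃ ω : Fin 3 → Fin 3 → C.Form, C.IsLeftBasis ω ∧
    (∀ i j k l : Fin 3, ω i j <• GLq.z q k l =
      ∑ d, ∑ e, ∑ a, ∑ b,
        (t * (GLq.Rmat q)⁻¹ (d, a) (e, i) * (GLq.Rmat q)⁻¹ (j, e) (b, l)) •
          GLq.z q k d • ω a b) ∧
    C.IsInnerBy ω

/-- `C` is (a copy of) the calculus `Γ₂(t)`: the free left module on `ω_i^j` (written `ω i j`) with
right multiplication
`ω_i^j z^k_l = t z^k_d R^a_i^d_e R^e_l^j_b ω_a^b` and `d = (q - q⁻¹)⁻¹ [Tr ω, ·]`. -/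
def IsGamma2 (C : FirstOrderCalculus (GLq q)) (t : ℂ) : Prop :=
  ∃ ω : Fin 3 → Fin 3 → C.Form, C.IsLeftBasis ω ∧
    (∀ i j k l : Fin 3, ω i j <• GLq.z q k l =
      ∑ d, ∑ e, ∑ a, ∑ b,
        (t * GLq.Rmat q (a, d) (i, e) * GLq.Rmat q (e, j) (l, b)) •
          GLq.z q k d • ω a b) ∧
    C.IsInnerBy ω

end GLq

end FirstOrderCalculus

/-- The coefficient `σ`. -/
def sigma1 (q t : ℂ) : ℂ :=
  ((q ^ 2 - t) * (t - 1)) / (q ^ 4 * (q ^ 2 + 1) * (t - 1) - q ^ 2 + t)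

/-- The coefficient `β`. -/
def beta1 (q t : ℂ) : ℂ :=
  (t * (q ^ 2 - 1) * (t - 1)) / (q ^ 4 * (q ^ 2 + 1) * (t - 1) - q ^ 2 + t)

/-- The coefficient `σ̂`. -/
def sigma2 (q t : ℂ) : ℂ :=
  -(((q ^ 2 * t - 1) * (t - 1)) / (q ^ 4 * (q ^ 2 * t - 1) + (q ^ 2 + 1) * (t - 1)))

/-- The coefficient `β̂`. -/
def beta2 (q t : ℂ) : ℂ :=
  -((t * (q ^ 2 - 1) * (t - 1)) / (q ^ 4 * (q ^ 2 * t - 1) + (q ^ 2 + 1) * (t - 1)))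

namespace FirstOrderCalculus

open GLq in
/-- The commutation relations of the first family. -/
structure Relations1 {q : ℂ} (C : FirstOrderCalculus (GLq q)) (t : ℂ) : Prop where
  same (i j : Fin 3) :
    C.dz i j <• z q i j = (t / q ^ 2 + t - 1) • z q i j • C.dz i j
      + sigma1 q t • (z q i j * z q i j) • C.trTheta
  row (i j l : Fin 3) (hjl : j < l) :
    C.dz i j <• z q i l = (t / q) • z q i l • C.dz i j + (t - 1) • z q i j • C.dz i l
      + sigma1 q t • (z q i j * z q i l) • C.trTheta
  col (i j k : Fin 3) (hik : i < k) :
    C.dz i j <• z q k j = (t / q) • z q k j • C.dz i j + (t - 1) • z q i j • C.dz k j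
      + sigma1 q t • (z q i j * z q k j) • C.trTheta
  diag (i j k l : Fin 3) (hik : i < k) (hjl : j < l) :
    C.dz i j <• z q k l = t • z q k l • C.dz i j + (t - 1) • z q i j • C.dz k l
      + sigma1 q t • (z q i j * z q k l) • C.trTheta
      - beta1 q t • (z q i j * z q k l - q • (z q i l * z q k j)) • C.trTheta
  anti (i j k l : Fin 3) (hik : i < k) (hlj : l < j) :
    C.dz i j <• z q k l = t • z q k l • C.dz i j + (t - 1) • z q i j • C.dz k l
      + sigma1 q t • (z q i j * z q k l) • C.trTheta
      - (t * (q - 1 / q)) • z q k j • C.dz i l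
      + (q * beta1 q t) • (z q i l * z q k j - q • (z q i j * z q k l)) • C.trTheta

open GLq in
/-- The commutation relations of the second family. -/
structure Relations2 {q : ℂ} (C : FirstOrderCalculus (GLq q)) (t : ℂ) : Prop where
  same (i j : Fin 3) :
    C.dz i j <• z q i j = (t * q ^ 2 + t - 1) • z q i j • C.dz i j
      + sigma2 q t • (z q i j * z q i j) • C.trTheta
  row (i j l : Fin 3) (hjl : j < l) :
    C.dz i j <• z q i l = (t * q) • z q i l • C.dz i j + (t * q ^ 2 - 1) • z q i j • C.dz i l
      + sigma2 q t • (z q i j * z q i l) • C.trTheta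
  col (i j k : Fin 3) (hik : i < k) :
    C.dz i j <• z q k j = (t * q) • z q k j • C.dz i j + (t * q ^ 2 - 1) • z q i j • C.dz k j
      + sigma2 q t • (z q i j * z q k j) • C.trTheta
  diag (i j k l : Fin 3) (hik : i < k) (hjl : j < l) :
    C.dz i j <• z q k l = t • z q k l • C.dz i j + (t - 1) • z q i j • C.dz k l
      + sigma2 q t • (z q i j * z q k l) • C.trTheta
      + (t * (q - 1 / q)) • (z q i l • C.dz k j + z q k j • C.dz i l)
      + (t * (q - 1 / q) ^ 2) • z q i j • C.dz k l
      - (1 / q ^ 2 * beta2 q t) • (z q i j * z q k l - q • (z q i l * z q k j)) • C.trTheta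
  anti (i j k l : Fin 3) (hik : i < k) (hlj : l < j) :
    C.dz i j <• z q k l = t • z q k l • C.dz i j + (t - 1) • z q i j • C.dz k l
      + sigma2 q t • (z q i j * z q k l) • C.trTheta
      + (t * (q - 1 / q)) • z q i l • C.dz k j
      + (1 / q * beta2 q t) • (z q i l * z q k j - q • (z q i j * z q k l)) • C.trTheta

end FirstOrderCalculus

end

namespace GLq

/-- The diagonal parameter of the braiding: `q⁻¹` for the first family, `q` for the second. -/
noncomputable def twist (q : ℂ) : Bool → ℂ
  | false => q⁻¹
  | true => q

/-- The off-diagonal parameter of the braiding. -/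
noncomputable def gap (q : ℂ) (ν : Bool) : ℂ := twist q ν - (twist q ν)⁻¹

/-- The coefficient of `e_x ⊗ e_y` in the image of `e_x ⊗ e_y` under the braiding. -/
noncomputable def diagCoeff (q : ℂ) (ν : Bool) (x y : Fin 3) : ℂ := if x = y then twist q ν else 1

/-- The coefficient of `e_y ⊗ e_x` in the image of `e_x ⊗ e_y` under the braiding. -/
noncomputable def flipCoeff (q : ℂ) : Bool → Fin 3 → Fin 3 → ℂ
  | false, x, y => if y < x then gap q false else 0
  | true, x, y => if x < y then gap q true else 0

/-- The braiding matrix: `R⁻¹` for the first family and `R₂₁` for the second. -/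
noncomputable def braid (q : ℂ) (ν : Bool) (x y d b : Fin 3) : ℂ :=
  diagCoeff q ν x y * ((if x = d then 1 else 0) * (if y = b then 1 else 0))
    + flipCoeff q ν x y * ((if x = b then 1 else 0) * (if y = d then 1 else 0))

section braid
variable {M : Type*} [AddCommGroup M] [Module ℂ M] (q : ℂ) (ν : Bool)

theorem sum_braid_smul_right (x y : Fin 3) (F : Fin 3 → Fin 3 → M) :
    ∑ d, ∑ b, braid q ν x y d b • F d b = diagCoeff q ν x y • F x y + flipCoeff q ν x y • F y x := by
  simp [braid, add_smul, Finset.sum_add_distrib, ite_smul]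

theorem flipCoeff_self (x : Fin 3) : flipCoeff q ν x x = 0 := by
  cases ν <;> simp [flipCoeff]

theorem sum_braid_smul_left (d b : Fin 3) (F : Fin 3 → Fin 3 → M) :
    ∑ x, ∑ y, braid q ν x y d b • F x y = diagCoeff q ν d b • F d b + flipCoeff q ν b d • F b d := by
  simp [braid, add_smul, Finset.sum_add_distrib, ite_smul]

theorem sum_braid_mul_right (x y : Fin 3) (F : Fin 3 → Fin 3 → ℂ) :
    ∑ d, ∑ b, braid q ν x y d b * F d b = diagCoeff q ν x y * F x y + flipCoeff q ν x y * F y x :=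
  sum_braid_smul_right q ν x y F

/-- The Yang-Baxter equation. -/
theorem braid_yang_baxter [NeZero q] (x y g h l j : Fin 3) :
    ∑ d, ∑ b, ∑ a, braid q ν x y d b * (braid q ν d g h a * braid q ν b a l j) =
      ∑ e, ∑ a, ∑ b, braid q ν y g e a * (braid q ν x a b j * braid q ν b e h l) := by
  have hq : q ≠ 0 := NeZero.ne q
  simp only [← Finset.mul_sum, sum_braid_mul_right]
  have h1 : ∀ d b, ∑ a, braid q ν d g h a * braid q ν b a l j =
      diagCoeff q ν d g * ((if d = h then 1 else 0) * braid q ν b g l j) +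
        flipCoeff q ν d g * ((if g = h then 1 else 0) * braid q ν b d l j) := by
    intro d b
    conv_lhs => enter [2, a]; rw [braid]
    simp [add_mul, Finset.sum_add_distrib]
  have h2 : ∀ a e, ∑ b, braid q ν x a b j * braid q ν b e h l =
      diagCoeff q ν x a * ((if a = j then 1 else 0) * braid q ν x e h l) +
        flipCoeff q ν x a * ((if x = j then 1 else 0) * braid q ν a e h l) := by
    intro a e
    conv_lhs => enter [2, b]; rw [braid]
    simp [add_mul, Finset.sum_add_distrib]
  simp only [h1, h2]
  simp only [braid]
  generalize hD : (fun a b : Fin 3 => (if a = b then (1 : ℂ) else 0)) = D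
  have hD' : ∀ a b : Fin 3, (if a = b then (1 : ℂ) else 0) = D a b := by
    intro a b; rw [← hD]
  simp only [hD']
  clear hD hD' h1 h2
  cases ν <;> fin_cases x <;> fin_cases y <;> fin_cases g <;>
    simp [diagCoeff, flipCoeff, gap, twist, -mul_eq_mul_left_iff, -mul_eq_mul_right_iff] <;> field_simp <;> ring

/-- The Hecke relation. -/
theorem braid_hecke [NeZero q] (d a b l : Fin 3) :
    ∑ e, ∑ i, braid q ν d a e i * braid q ν i e b l =
      (if d = l then 1 else 0) * (if a = b then 1 else 0) + gap q ν * braid q ν d a b l := by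
  have hq : q ≠ 0 := NeZero.ne q
  simp only [sum_braid_mul_right]
  simp only [braid]
  generalize hD : (fun a b : Fin 3 => (if a = b then (1 : ℂ) else 0)) = D
  have hD' : ∀ a b : Fin 3, (if a = b then (1 : ℂ) else 0) = D a b := by
    intro a b; rw [← hD]
  simp only [hD']
  clear hD hD'
  cases ν <;> fin_cases d <;> fin_cases a <;>
    simp [diagCoeff, flipCoeff, gap, twist, -mul_eq_mul_left_iff, -mul_eq_mul_right_iff] <;> field_simp <;> ring

theorem Rmat_apply (i k j l : Fin 3) :
    Rmat q (i, k) (j, l) = (if i = k then q else 1) * ((if i = j then 1 else 0) * (if k = l then 1 else 0))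
      + (if k < i then q - q⁻¹ else 0) * ((if i = l then 1 else 0) * (if k = j then 1 else 0)) := by
  simp only [Rmat, Matrix.add_apply, Matrix.smul_apply, Matrix.sum_apply, Matrix.kroneckerMap_apply,
    Matrix.single_apply, smul_eq_mul, apply_ite (fun M : Matrix (Fin 3 × Fin 3) (Fin 3 × Fin 3) ℂ => M (i, k) (j, l)),
    Matrix.zero_apply]
  congr 1
  · rw [Finset.sum_eq_single i, Finset.sum_eq_single k]
    · simp
    · intro b _ hb; simp [hb]
    · simp
    · intro b _ hb; simp [hb]
    · simp
  · rw [Finset.sum_eq_single i, Finset.sum_eq_single k]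
    · by_cases h : k < i <;> simp [h]
      split_ifs <;> rfl
    · intro b _ hb; simp [hb]
    · simp
    · intro b _ hb; simp [hb]
    · simp

theorem Rmat_eq_braid (a d i e : Fin 3) : Rmat q (a, d) (i, e) = braid q true d a e i := by
  rw [Rmat_apply]
  simp [braid, diagCoeff, flipCoeff, gap, twist, eq_comm]
  congr 1
  · by_cases h : a = i <;> simp [h]
  · by_cases h : a = e <;> simp [h]

theorem Rmat_inv_eq_braid [NeZero q] (d a e i : Fin 3) :
    (Rmat q)⁻¹ (d, a) (e, i) = braid q false d a e i := by
  have hq : q ≠ 0 := NeZero.ne q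
  have : (Rmat q)⁻¹ = Matrix.of fun x y => braid q false x.1 x.2 y.1 y.2 := by
    refine Matrix.inv_eq_left_inv ?_
    ext ⟨x, y⟩ ⟨u, w⟩
    rw [Matrix.mul_apply, Fintype.sum_prod_type]
    simp only [Matrix.of_apply, sum_braid_mul_right]
    simp only [Rmat_apply, Matrix.one_apply, Prod.mk.injEq]
    have : (if x = u ∧ y = w then (1 : ℂ) else 0) =
        (if x = u then (1 : ℂ) else 0) * (if y = w then (1 : ℂ) else 0) := by
      split_ifs <;> simp_all
    rw [this]
    generalize hD : (fun a b : Fin 3 => (if a = b then (1 : ℂ) else 0)) = D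
    have hD' : ∀ a b : Fin 3, (if a = b then (1 : ℂ) else 0) = D a b := by
      intro a b; rw [← hD]
    simp only [hD']
    clear hD hD' this
    fin_cases x <;> fin_cases y <;>
    simp [diagCoeff, flipCoeff, gap, twist, -mul_eq_mul_left_iff, -mul_eq_mul_right_iff] <;> field_simp <;> ring
  rw [this]; rfl

end braid
end GLq

namespace GLq

theorem induction_on {q : ℂ} {P : GLq q → Prop} (a : GLq q) (hc : ∀ c : ℂ, P (algebraMap ℂ (GLq q) c))
    (hz : ∀ i j, P (z q i j)) (hadd : ∀ a b, P a → P b → P (a + b))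
    (hmul : ∀ a b, P a → P b → P (a * b)) (hinv : P (qdet q (z q)) → P (detInv q)) : P a := by
  have hs : ∀ (c : ℂ) a, P a → P (c • a) := fun c a h => by
    rw [Algebra.smul_def]; exact hmul _ _ (hc c) h
  have hsub : ∀ a b, P a → P b → P (a - b) := fun a b h h' => by
    rw [sub_eq_add_neg, ← neg_one_smul ℂ b]; exact hadd _ _ h (hs _ _ h')
  have hd : P (qdet q (z q)) := by
    unfold qdet
    have h3 : ∀ i j k l m n, P (z q i j * z q k l * z q m n) := fun i j k l m n =>
      hmul _ _ (hmul _ _ (hz _ _) (hz _ _)) (hz _ _)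
    exact hsub _ _ (hsub _ _ (hsub _ _ (hadd _ _ (hadd _ _ (h3 ..) (hs _ _ (h3 ..)))
      (hs _ _ (h3 ..))) (hs _ _ (h3 ..))) (hs _ _ (h3 ..))) (hs _ _ (h3 ..))
  obtain ⟨w, rfl⟩ := RingQuot.mkAlgHom_surjective ℂ (GLqRel q) a
  induction w using FreeAlgebra.induction with
  | grade0 c => rw [AlgHom.commutes]; exact hc c
  | grade1 g =>
    cases g with
    | z i j => exact hz i j
    | detInv => exact hinv hd
  | mul a b ha hb => rw [map_mul]; exact hmul _ _ ha hb
  | add a b ha hb => rw [map_add]; exact hadd _ _ ha hb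

section rtt
variable {B : Type*} [Ring B] [Algebra ℂ B] (q : ℂ) [NeZero q] (ν : Bool)

/-- The quadratic relations `X₁ X₂ K = K X₂ X₁` of a quantum matrix with respect to the braiding
matrix `K`. -/
def IsQuantumMatrix (x : Fin 3 → Fin 3 → B) : Prop :=
  ∀ m b l i, ∑ d, ∑ a, braid q ν d a l i • (x m d * x b a) =
    ∑ n, ∑ a, braid q ν m b n a • (x a i * x n l)

variable {q ν}

theorem isQuantumMatrix_iff {x : Fin 3 → Fin 3 → B} : IsQuantumMatrix q ν x ↔
    ∀ m b l i, diagCoeff q ν l i • (x m l * x b i) + flipCoeff q ν i l • (x m i * x b l) =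
      diagCoeff q ν m b • (x b i * x m l) + flipCoeff q ν m b • (x m i * x b l) := by
  unfold IsQuantumMatrix
  simp only [sum_braid_smul_left q ν _ _ (fun d a => x _ d * x _ a),
    sum_braid_smul_right q ν _ _ (fun n a => x a _ * x n _)]

variable (q ν)

theorem isQuantumMatrix_z : IsQuantumMatrix q ν (z q) := by
  have hq : q ≠ 0 := NeZero.ne q
  rw [isQuantumMatrix_iff]
  intro m b l i
  rcases lt_trichotomy m b with hmb | rfl | hmb <;> rcases lt_trichotomy l i with hli | rfl | hli
  · rw [z_cross' q m l b i hmb hli]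
    cases ν <;> simp [diagCoeff, flipCoeff, gap, twist, hmb.ne, hli.ne, hmb, hli, hmb.not_gt, hli.not_gt] <;>
      module
  · rw [z_col' q m b l hmb]
    cases ν <;> simp [diagCoeff, flipCoeff, gap, twist, hmb.ne, hmb, hmb.not_gt] <;> match_scalars <;>
      field_simp <;> ring
  · rw [z_comm q m l b i hmb hli]
    cases ν <;> simp [diagCoeff, flipCoeff, gap, twist, hmb.ne, hli.ne', hmb, hli, hmb.not_gt, hli.not_gt]
  · rw [z_row' q m l i hli]
    cases ν <;> simp [diagCoeff, flipCoeff, gap, twist, hli.ne, hli, hli.not_gt] <;> match_scalars <;>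
      field_simp <;> ring
  · cases ν <;> simp [diagCoeff, flipCoeff, twist]
  · rw [z_row' q m i l hli]
    cases ν <;> simp [diagCoeff, flipCoeff, gap, twist, hli.ne', hli, hli.not_gt] <;> match_scalars <;>
      field_simp <;> ring
  · rw [← z_comm q b i m l hmb hli]
    cases ν <;> simp [diagCoeff, flipCoeff, gap, twist, hmb.ne', hli.ne, hmb, hli, hmb.not_gt, hli.not_gt]
  · rw [z_col' q b m l hmb]
    cases ν <;> simp [diagCoeff, flipCoeff, gap, twist, hmb.ne', hmb, hmb.not_gt] <;> match_scalars <;>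
      field_simp <;> ring
  · rw [z_cross' q b i m l hmb hli, z_comm q b l m i hmb hli]
    cases ν <;> simp [diagCoeff, flipCoeff, gap, twist, hmb.ne', hli.ne', hmb, hli, hmb.not_gt, hli.not_gt] <;>
      module

variable {q ν}

theorem IsQuantumMatrix.smul {x : Fin 3 → Fin 3 → B} (h : IsQuantumMatrix q ν x) (t : ℂ) :
    IsQuantumMatrix q ν (fun i j => t • x i j) := by
  intro m b l i
  simp only [smul_mul_smul_comm, smul_comm _ (t * t), ← Finset.smul_sum, h m b l i]

theorem IsQuantumMatrix.row {x : Fin 3 → Fin 3 → B} (h : IsQuantumMatrix q ν x) (i j k : Fin 3)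
    (hjk : j < k) : x i j * x i k = q • (x i k * x i j) := by
  have hq : q ≠ 0 := NeZero.ne q
  rw [isQuantumMatrix_iff] at h
  have h1 := h i i j k
  have h2 := h i i k j
  cases ν <;> simp [diagCoeff, flipCoeff, gap, twist, hjk.ne, hjk.ne', hjk, hjk.not_gt] at h1 h2
  · rw [h2, smul_smul, mul_inv_cancel₀ hq, one_smul]
  · exact h1

theorem IsQuantumMatrix.col {x : Fin 3 → Fin 3 → B} (h : IsQuantumMatrix q ν x) (i k j : Fin 3)
    (hik : i < k) : x i j * x k j = q • (x k j * x i j) := by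
  have hq : q ≠ 0 := NeZero.ne q
  rw [isQuantumMatrix_iff] at h
  have h1 := h i k j j
  have h2 := h k i j j
  cases ν <;> simp [diagCoeff, flipCoeff, gap, twist, hik.ne, hik.ne', hik, hik.not_gt] at h1 h2
  · rw [← h1, smul_smul, mul_inv_cancel₀ hq, one_smul]
  · rw [← h2]

theorem IsQuantumMatrix.comm {x : Fin 3 → Fin 3 → B} (h : IsQuantumMatrix q ν x) (i j k l : Fin 3)
    (hik : i < k) (hlj : l < j) : x i j * x k l = x k l * x i j := by
  have hq : q ≠ 0 := NeZero.ne q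
  rw [isQuantumMatrix_iff] at h
  have h1 := h i k j l
  have h2 := h k i l j
  cases ν <;> simp [diagCoeff, flipCoeff, gap, twist, hik.ne, hik.ne', hik, hik.not_gt,
    hlj.ne, hlj.ne', hlj, hlj.not_gt] at h1 h2
  · exact h1
  · exact h2.symm

theorem IsQuantumMatrix.cross {x : Fin 3 → Fin 3 → B} (h : IsQuantumMatrix q ν x) (i j k l : Fin 3)
    (hik : i < k) (hjl : j < l) : x i j * x k l = x k l * x i j + (q - q⁻¹) • (x k j * x i l) := by
  have hq : q ≠ 0 := NeZero.ne q
  have h3 := h.comm i l k j hik hjl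
  rw [isQuantumMatrix_iff] at h
  have h1 := h i k j l
  have h2 := h k i l j
  cases ν <;> simp [diagCoeff, flipCoeff, gap, twist, hik.ne, hik.ne', hik, hik.not_gt,
    hjl.ne, hjl.ne', hjl, hjl.not_gt] at h1 h2
  · rw [← h3, ← h1]; module
  · rw [← h2]

variable (q) in
/-- The universal property of `Fun_q(GL(3,ℂ))`. -/
noncomputable def lift (x : Fin 3 → Fin 3 → B) (h : IsQuantumMatrix q ν x) (u : B)
    (h1 : qdet q x * u = 1) (h2 : u * qdet q x = 1) : GLq q →ₐ[ℂ] B :=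
  RingQuot.liftAlgHom ℂ ⟨FreeAlgebra.lift ℂ fun g => match g with
    | .z i j => x i j
    | .detInv => u, by
      intro y y' hy
      cases hy with
      | row i j k hjk => simpa using h.row i j k hjk
      | col i k j hik => simpa using h.col i k j hik
      | comm i j k l hik hlj => simpa using h.comm i j k l hik hlj
      | cross i j k l hik hjl => simpa using h.cross i j k l hik hjl
      | det_mul_detInv =>
        rw [map_mul, map_qdet, map_one]
        simpa only [FreeAlgebra.lift_ι_apply] using h1
      | detInv_mul_det =>
        rw [map_mul, map_qdet, map_one]
        simpa only [FreeAlgebra.lift_ι_apply] using h2⟩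

theorem lift_z (x : Fin 3 → Fin 3 → B) (h : IsQuantumMatrix q ν x) (u : B)
    (h1 : qdet q x * u = 1) (h2 : u * qdet q x = 1) (i j : Fin 3) :
    lift q x h u h1 h2 (z q i j) = x i j := by
  simp only [lift, z]
  erw [RingQuot.liftAlgHom_mkAlgHom_apply]
  simp

end rtt

section representations
variable (q : ℂ) [NeZero q] (ν : Bool)

/-- The representation of the generators by `(f⁺(z^d_l))_{i a} = K^{d a}_{l i}`. -/
noncomputable def repA (d l : Fin 3) : Matrix (Fin 3) (Fin 3) ℂ := Matrix.of fun i a => braid q ν d a l i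

/-- The representation of the generators by `(f⁻(z^d_l))_{j b} = K^{j d}_{b l}`. -/
noncomputable def repB (d l : Fin 3) : Matrix (Fin 3) (Fin 3) ℂ := Matrix.of fun j b => braid q ν j d b l

theorem isQuantumMatrix_repA : IsQuantumMatrix q ν (repA q ν) := by
  intro m b l i
  ext u w
  have := braid_yang_baxter q ν m b w l i u
  simp only [repA, Matrix.sum_apply, Matrix.smul_apply, Matrix.mul_apply, Matrix.of_apply,
    smul_eq_mul, Finset.mul_sum]
  rw [Finset.sum_comm' (t' := Finset.univ) (s' := fun _ => Finset.univ) (by simp)]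
  simp only [Fin.sum_univ_three] at this ⊢
  linear_combination -this

theorem isQuantumMatrix_repB : IsQuantumMatrix q ν (repB q ν) := by
  intro m b l i
  ext j w
  have := braid_yang_baxter q ν j m b w l i
  simp only [repB, Matrix.sum_apply, Matrix.smul_apply, Matrix.mul_apply, Matrix.of_apply,
    smul_eq_mul, Finset.mul_sum]
  simp only [Fin.sum_univ_three] at this ⊢
  linear_combination this

theorem qdet_repA : qdet q (repA q ν) = twist q ν • 1 := by
  have hq : q ≠ 0 := NeZero.ne q
  ext i j
  cases ν <;> fin_cases i <;> fin_cases j <;>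
    simp [qdet, repA, Matrix.mul_apply, Fin.sum_univ_three, braid, diagCoeff, flipCoeff, gap, twist]

theorem qdet_repB : qdet q (repB q ν) = twist q ν • 1 := by
  have hq : q ≠ 0 := NeZero.ne q
  ext i j
  cases ν <;> fin_cases i <;> fin_cases j <;>
    simp [qdet, repB, Matrix.mul_apply, braid, diagCoeff, flipCoeff, gap, twist]

end representations
end GLq

namespace GLq

/-- The matrix of signed quantum minors, `S(Z) = 𝒟⁻¹ cof(Z)`. -/
noncomputable def cofactor (q : ℂ) : Matrix (Fin 3) (Fin 3) (GLq q) := !![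
    z q 1 1 * z q 2 2 - q • (z q 1 2 * z q 2 1),
    -q⁻¹ • (z q 0 1 * z q 2 2) + z q 0 2 * z q 2 1,
    q⁻¹ ^ 2 • (z q 0 1 * z q 1 2) - q⁻¹ • (z q 0 2 * z q 1 1);
    -q • (z q 1 0 * z q 2 2) + q ^ 2 • (z q 1 2 * z q 2 0),
    z q 0 0 * z q 2 2 - q • (z q 0 2 * z q 2 0),
    -q⁻¹ • (z q 0 0 * z q 1 2) + z q 0 2 * z q 1 0;
    q ^ 2 • (z q 1 0 * z q 2 1) - q ^ 3 • (z q 1 1 * z q 2 0),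
    -q • (z q 0 0 * z q 2 1) + q ^ 2 • (z q 0 1 * z q 2 0),
    z q 0 0 * z q 1 1 - q • (z q 0 1 * z q 1 0)]

section
variable (q : ℂ) [NeZero q]

theorem z_mul_cofactor : Matrix.of (z q) * cofactor q = Matrix.scalar (Fin 3) (qdet q (z q)) := by
  have hq : q ≠ 0 := NeZero.ne q
  have r1 := fun i j k h X => congrArg (· * X) (z_row' q i j k h)
  have r3 := fun i j k l h h' X => congrArg (· * X) (z_comm' q i j k l h h')
  have r4 := fun i j k l h h' X => congrArg (· * X) (z_cross' q i j k l h h')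
  simp only [mul_assoc, smul_mul_assoc, sub_mul] at r1 r3 r4
  ext i j
  rw [Matrix.mul_apply, Fin.sum_univ_three]
  fin_cases i <;> fin_cases j <;>
  simp [cofactor, qdet, mul_sub, mul_add, -neg_smul] <;>
  simp (disch := decide) only [mul_assoc, r1, r3, r4, z_row', z_comm', z_cross', mul_smul_comm,
    mul_sub, smul_sub] <;> match_scalars <;> field_simp <;> ring

theorem cofactor_mul_z : cofactor q * Matrix.of (z q) = Matrix.scalar (Fin 3) (qdet q (z q)) := by
  have hq : q ≠ 0 := NeZero.ne q
  have r2 := fun i j k h X => congrArg (· * X) (z_col' q i j k h)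
  have r3 := fun i j k l h h' X => congrArg (· * X) (z_comm' q i j k l h h')
  have r4 := fun i j k l h h' X => congrArg (· * X) (z_cross' q i j k l h h')
  simp only [mul_assoc, smul_mul_assoc, sub_mul] at r2 r3 r4
  ext i j
  rw [Matrix.mul_apply, Fin.sum_univ_three]
  fin_cases i <;> fin_cases j <;>
  simp [cofactor, qdet, sub_mul, add_mul, -neg_smul] <;>
  simp (disch := decide) only [mul_assoc, r2, r3, r4, z_col', z_comm', z_cross', mul_smul_comm,
    mul_sub, smul_sub] <;> match_scalars <;> field_simp <;> ring

theorem qdet_mul_z (i j : Fin 3) : qdet q (z q) * z q i j = z q i j * qdet q (z q) := by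
  have h : Matrix.scalar (Fin 3) (qdet q (z q)) * Matrix.of (z q) =
      Matrix.of (z q) * Matrix.scalar (Fin 3) (qdet q (z q)) := by
    rw [← z_mul_cofactor, mul_assoc, cofactor_mul_z, z_mul_cofactor]
  simpa using congrFun (congrFun h i) j

theorem z_mul_detInv (i j : Fin 3) : z q i j * detInv q = detInv q * z q i j := by
  calc z q i j * detInv q = detInv q * (qdet q (z q) * z q i j) * detInv q := by
        rw [← mul_assoc, detInv_mul_qdet, one_mul]
    _ = detInv q * z q i j := by
        rw [qdet_mul_z, mul_assoc, mul_assoc, qdet_mul_detInv, mul_one]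

theorem antipodeZ_eq : Matrix.of (antipodeZ q) = Matrix.scalar (Fin 3) (detInv q) * cofactor q := by
  ext i j
  simp [antipodeZ, cofactor]

theorem antipodeZ_mul_z : Matrix.of (antipodeZ q) * Matrix.of (z q) = 1 := by
  rw [antipodeZ_eq, mul_assoc, cofactor_mul_z, ← map_mul, detInv_mul_qdet, map_one]

theorem z_mul_antipodeZ : Matrix.of (z q) * Matrix.of (antipodeZ q) = 1 := by
  have : Matrix.of (z q) * Matrix.scalar (Fin 3) (detInv q) =
      Matrix.scalar (Fin 3) (detInv q) * Matrix.of (z q) := by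
    ext i j; simp [z_mul_detInv]
  rw [antipodeZ_eq, ← mul_assoc, this, mul_assoc, z_mul_cofactor, ← map_mul, detInv_mul_qdet, map_one]

theorem sum_antipodeZ_mul_z (i j : Fin 3) :
    ∑ k, antipodeZ q i k * z q k j = if i = j then 1 else 0 := by
  simpa [Matrix.mul_apply, Matrix.one_apply] using congrFun (congrFun (antipodeZ_mul_z q) i) j

theorem sum_z_mul_antipodeZ (i j : Fin 3) :
    ∑ k, z q i k * antipodeZ q k j = if i = j then 1 else 0 := by
  simpa [Matrix.mul_apply, Matrix.one_apply] using congrFun (congrFun (z_mul_antipodeZ q) i) j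

end
end GLq

/-- A family is a basis of a left module over a possibly noncommutative ring. -/
def IsBasisFamily (A : Type*) {M ι : Type*} [Ring A] [AddCommGroup M] [Module A M] (v : ι → M) : Prop :=
  LinearIndependent A v ∧ Submodule.span A (Set.range v) = ⊤

theorem IsBasisFamily.of_matrix {A M ι : Type*} [Ring A] [AddCommGroup M] [Module A M] [Fintype ι]
    [DecidableEq ι] {v : ι → M} (hv : IsBasisFamily A v) (B B' : Matrix ι ι A) (h : B * B' = 1)
    (h' : B' * B = 1) {w : ι → M} (hw : ∀ p, w p = ∑ i, B p i • v i) : IsBasisFamily A w := by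
  constructor
  · rw [Fintype.linearIndependent_iff]
    intro g hg
    have h1 : ∑ i, (∑ p, g p * B p i) • v i = 0 := by
      rw [← hg]
      simp only [hw, Finset.smul_sum, Finset.sum_smul, mul_smul]
      exact Finset.sum_comm
    have h2 := Fintype.linearIndependent_iff.1 hv.1 _ h1
    have h3 : Matrix.vecMul g B = 0 := funext h2
    have h4 : Matrix.vecMul (Matrix.vecMul g B) B' = g := by
      rw [Matrix.vecMul_vecMul, h, Matrix.vecMul_one]
    rw [h3, Matrix.zero_vecMul] at h4
    exact fun i => (congrFun h4 i).symm
  · rw [eq_top_iff, ← hv.2, Submodule.span_le]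
    rintro _ ⟨i, rfl⟩
    have : v i = ∑ p, B' i p • w p := by
      simp only [hw, Finset.smul_sum, smul_smul]
      rw [Finset.sum_comm]
      simp only [← Finset.sum_smul]
      have h5 : ∀ j, ∑ p, B' i p * B p j = (1 : Matrix ι ι A) i j := fun j => by rw [← h']; rfl
      simp [h5, Matrix.one_apply]
    rw [this]
    exact Submodule.sum_mem _ fun p _ => Submodule.smul_mem _ _ (Submodule.subset_span ⟨p, rfl⟩)

namespace GLq

/-- The sign relating `gap q ν` to `q - q⁻¹`. -/
def sign : Bool → ℂ
  | false => -1
  | true => 1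

theorem gap_eq (q : ℂ) (ν : Bool) : gap q ν = sign ν * (q - q⁻¹) := by
  cases ν <;> simp [gap, sign, twist]

/-- The normalization relating `Tr_q θ` to `Tr ω`. -/
noncomputable def traceCoeff (q t : ℂ) : Bool → ℂ
  | false => (q ^ 4 * (q ^ 2 + 1) * (t - 1) - q ^ 2 + t) / (q * (q ^ 2 - 1))
  | true => q * (q ^ 4 * (q ^ 2 * t - 1) + (q ^ 2 + 1) * (t - 1)) / (q ^ 2 - 1)

section trace
variable {M : Type*} [AddCommGroup M] [Module ℂ M] (q t : ℂ) [NeZero q] (ν : Bool)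

/-- The Maurer-Cartan forms as combinations of the left-invariant basis `ω`. -/
noncomputable def mcForm (ω : Fin 3 → Fin 3 → M) (d l : Fin 3) : M :=
  ((q - q⁻¹)⁻¹ * (t - 1) * if d = l then 1 else 0) • ∑ i, ω i i
    + (sign ν * t) • ∑ a, ∑ b, braid q ν d a b l • ω a b

theorem mcForm_eq (ω : Fin 3 → Fin 3 → M) (d l : Fin 3) : mcForm q t ν ω d l =
    ((q - q⁻¹)⁻¹ * (t - 1) * if d = l then 1 else 0) • ∑ i, ω i i
    + (sign ν * t) • (diagCoeff q ν d l • ω l d +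
      if d = l then ∑ a, flipCoeff q ν d a • ω a a else 0) := by
  unfold mcForm
  congr 2
  simp only [braid, add_smul, Finset.sum_add_distrib]
  congr 1
  · rw [Finset.sum_eq_single l, Finset.sum_eq_single d]
    · simp
    · intro b _ hb; simp [hb.symm]
    · simp
    · intro b _ hb; simp [hb]
    · simp
  · split_ifs with h <;> simp

theorem qtrace_mcForm (hs : q ^ 2 ≠ 1) (ω : Fin 3 → Fin 3 → M) :
    q ^ 4 • mcForm q t ν ω 0 0 + q ^ 2 • mcForm q t ν ω 1 1 + mcForm q t ν ω 2 2 =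
      traceCoeff q t ν • ∑ i, ω i i := by
  have hq : q ≠ 0 := NeZero.ne q
  have hs' : q ^ 2 - 1 ≠ 0 := sub_ne_zero.2 hs
  have e : (q - q⁻¹)⁻¹ = q / (q ^ 2 - 1) := by
    rw [inv_eq_one_div, div_eq_div_iff]
    · field_simp
    · intro h; apply hs'; field_simp at h; simpa using h
    · exact hs'
  cases ν <;>
  simp [mcForm_eq, Fin.sum_univ_three, diagCoeff, flipCoeff, traceCoeff, gap, twist, sign, e, -neg_smul] <;>
  match_scalars <;> field_simp <;> ring

theorem mcForm_injective (hs : q ^ 2 ≠ 1) (ht : t ≠ 0) (hc : traceCoeff q t ν ≠ 0)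
    {ω : Fin 3 → Fin 3 → M} (h : ∀ d l, mcForm q t ν ω d l = 0) (i j : Fin 3) : ω i j = 0 := by
  have hq : q ≠ 0 := NeZero.ne q
  have hT : ∑ i, ω i i = 0 := by
    have := qtrace_mcForm q t ν hs ω
    simp only [h, smul_zero, add_zero] at this
    exact (smul_eq_zero.1 this.symm).resolve_left hc
  have hst : sign ν * t ≠ 0 := by cases ν <;> simpa [sign]
  have hd : ∀ d l, diagCoeff q ν d l ≠ 0 := by
    intro d l; unfold diagCoeff; split_ifs <;> cases ν <;> simp [twist, hq]
  have h' : ∀ d l, diagCoeff q ν d l • ω l d +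
      (if d = l then ∑ a, flipCoeff q ν d a • ω a a else 0) = 0 := by
    intro d l
    have := h d l
    rw [mcForm_eq, hT, smul_zero, zero_add] at this
    exact (smul_eq_zero.1 this).resolve_left hst
  have hdiag : ∀ i, ω i i = 0 := by
    have h0 := h' 0 0
    have h1 := h' 1 1
    have h2 := h' 2 2
    cases ν
    · simp [Fin.sum_univ_three, flipCoeff] at h0 h1 h2
      have e0 : ω 0 0 = 0 := h0.resolve_left (hd 0 0)
      simp [e0] at h1 h2
      have e1 : ω 1 1 = 0 := h1.resolve_left (hd 1 1)
      simp [e1] at h2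
      have e2 : ω 2 2 = 0 := h2.resolve_left (hd 2 2)
      intro i; fin_cases i <;> assumption
    · simp [Fin.sum_univ_three, flipCoeff] at h0 h1 h2
      have e2 : ω 2 2 = 0 := h2.resolve_left (hd 2 2)
      simp [e2] at h1 h0
      have e1 : ω 1 1 = 0 := h1.resolve_left (hd 1 1)
      simp [e1] at h0
      have e0 : ω 0 0 = 0 := h0.resolve_left (hd 0 0)
      intro i; fin_cases i <;> assumption
  by_cases hij : i = j
  · rw [hij]; exact hdiag j
  · have := h' j i
    rw [if_neg (Ne.symm hij), add_zero] at this
    exact (smul_eq_zero.1 this).resolve_left (hd j i)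

/-- The matrix of the Maurer-Cartan forms in the basis `ω`. -/
noncomputable def mcMatrix : Matrix (Fin 3 × Fin 3) (Fin 3 × Fin 3) ℂ := Matrix.of fun p r =>
  ((q - q⁻¹)⁻¹ * (t - 1) * if p.1 = p.2 then 1 else 0) * (if r.1 = r.2 then 1 else 0)
    + (sign ν * t) * braid q ν p.1 r.1 r.2 p.2

theorem mcForm_eq_sum_mcMatrix (ω : Fin 3 → Fin 3 → M) (p : Fin 3 × Fin 3) :
    mcForm q t ν ω p.1 p.2 = ∑ r : Fin 3 × Fin 3, mcMatrix q t ν p r • ω r.1 r.2 := by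
  simp only [mcForm, mcMatrix, Matrix.of_apply, add_smul, Finset.sum_add_distrib,
    Fintype.sum_prod_type, mul_smul _ (braid _ _ _ _ _ _), Finset.smul_sum]
  congr 1
  simp

theorem isUnit_mcMatrix (hs : q ^ 2 ≠ 1) (ht : t ≠ 0) (hc : traceCoeff q t ν ≠ 0) :
    IsUnit (mcMatrix q t ν) := by
  rw [← Matrix.mulVec_injective_iff_isUnit]
  refine (injective_iff_map_eq_zero (Matrix.mulVecLin (mcMatrix q t ν))).2 fun x hx => ?_
  ext p
  refine mcForm_injective q t ν hs ht hc (ω := fun i j => x (i, j)) (fun d l => ?_) p.1 p.2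
  rw [mcForm_eq_sum_mcMatrix q t ν (fun i j => x (i, j)) (d, l)]
  exact congrFun hx (d, l)

end trace
end GLq

namespace GLq

section bimodule
variable {q : ℂ} [NeZero q] {M : Type*} [AddCommGroup M] [Module ℂ M] [Module (GLq q) M]
  [Module (GLq q)ᵐᵒᵖ M] [SMulCommClass (GLq q) (GLq q)ᵐᵒᵖ M] [IsScalarTower ℂ (GLq q) M]
  [IsScalarTower ℂ (GLq q)ᵐᵒᵖ M]

/-- The right multiplication rule of the basis forms of `Γ_ν(t)`. -/
def IsBraided (q t : ℂ) {M : Type*} [AddCommGroup M] [Module ℂ M] [Module (GLq q) M]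
    [Module (GLq q)ᵐᵒᵖ M] (ν : Bool) (ω : Fin 3 → Fin 3 → M) : Prop :=
  ∀ i j k l, ω i j <• z q k l = ∑ d, ∑ e, ∑ a, ∑ b,
    (t * braid q ν d a e i * braid q ν j e b l) • z q k d • ω a b

variable {t : ℂ} {ν : Bool} {ω : Fin 3 → Fin 3 → M}

theorem IsBraided.trace_mul_z (h : IsBraided q t ν ω) (k l : Fin 3) :
    (∑ i, ω i i) <• z q k l = t • z q k l • ∑ i, ω i i +
      (t * gap q ν) • ∑ d, z q k d • ∑ a, ∑ b, braid q ν d a b l • ω a b := by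
  have h1 : (∑ i, ω i i) <• z q k l = ∑ d, ∑ a, ∑ b,
      (t * ∑ e, ∑ i, braid q ν d a e i * braid q ν i e b l) • z q k d • ω a b := by
    simp only [Finset.smul_sum, h _ _ k l, Finset.mul_sum, Finset.sum_smul, ← mul_assoc]
    simp only [← Fintype.sum_prod_type']
    refine Fintype.sum_equiv
      ⟨fun ⟨i, d, e, a, b⟩ => ⟨d, a, b, e, i⟩, fun ⟨d, a, b, e, i⟩ => ⟨i, d, e, a, b⟩,
        fun _ => rfl, fun _ => rfl⟩ _ _ ?_
    rintro ⟨i, d, e, a, b⟩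
    simp only [Equiv.coe_fn_mk]
  rw [h1]
  simp only [braid_hecke, mul_add, add_smul, Finset.sum_add_distrib]
  congr 1
  · rw [Finset.sum_eq_single l]
    · simp [Finset.smul_sum]
    · intro b _ hb; simp [hb]
    · simp
  · simp only [Finset.smul_sum, ← mul_assoc, mul_smul _ (braid _ _ _ _ _ _), smul_comm (z q _ _) (_ : ℂ)]

/-- `d z^k_l = z^k_d θ^d_l` for the inner derivation defined by `Tr ω`. -/
theorem IsBraided.commutator_z (h : IsBraided q t ν ω) (hs : q - q⁻¹ ≠ 0) (k l : Fin 3) :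
    (q - q⁻¹)⁻¹ • ((∑ i, ω i i) <• z q k l - z q k l • ∑ i, ω i i) =
      ∑ d, z q k d • mcForm q t ν ω d l := by
  simp only [h.trace_mul_z, mcForm, smul_add, Finset.sum_add_distrib]
  have : ∑ d, z q k d • ((q - q⁻¹)⁻¹ * (t - 1) * if d = l then (1 : ℂ) else 0) • ∑ i, ω i i =
      ((q - q⁻¹)⁻¹ * (t - 1)) • z q k l • ∑ i, ω i i := by
    rw [Finset.sum_eq_single l]
    · rw [if_pos rfl, mul_one, smul_comm]
    · intro b _ hb; simp [hb]
    · simp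
  rw [this]
  simp only [smul_comm (z q _ _) (sign ν * t), ← Finset.smul_sum, gap_eq]
  obtain ⟨f, hf⟩ : ∃ f : GLq q → M → M, ∀ a m, a • m = f a m := ⟨_, fun _ _ => rfl⟩
  simp only [hf]
  generalize q - q⁻¹ = s at hs ⊢
  match_scalars <;> field_simp

/-- The forms `ψ^i_j = z^i_d K^{d a}_{b j} ω_a^b`. -/
noncomputable def psi (q : ℂ) {M : Type*} [AddCommGroup M] [Module ℂ M] [Module (GLq q) M]
    (ν : Bool) (ω : Fin 3 → Fin 3 → M) (i j : Fin 3) : M :=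
  ∑ d, z q i d • ∑ a, ∑ b, braid q ν d a b j • ω a b

theorem IsBraided.commutator_z_eq_psi (h : IsBraided q t ν ω) (hs : q - q⁻¹ ≠ 0) (k l : Fin 3) :
    (q - q⁻¹)⁻¹ • ((∑ i, ω i i) <• z q k l - z q k l • ∑ i, ω i i) =
      ((q - q⁻¹)⁻¹ * (t - 1)) • z q k l • (∑ i, ω i i) + (sign ν * t) • psi q ν ω k l := by
  simp only [h.trace_mul_z, psi, gap_eq]
  obtain ⟨f, hf⟩ : ∃ f : GLq q → M → M, ∀ a m, a • m = f a m := ⟨_, fun _ _ => rfl⟩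
  simp only [hf]
  generalize q - q⁻¹ = s at hs ⊢
  match_scalars <;> field_simp

theorem IsBraided.psi_mul_z (h : IsBraided q t ν ω) (i j k l : Fin 3) :
    psi q ν ω i j <• z q k l = t •
      (diagCoeff q ν i k • (diagCoeff q ν l j • z q k l • psi q ν ω i j
          + flipCoeff q ν j l • z q k j • psi q ν ω i l)
        + flipCoeff q ν i k • (diagCoeff q ν l j • z q i l • psi q ν ω k j
          + flipCoeff q ν j l • z q i j • psi q ν ω k l)) := by
  have h1 : psi q ν ω i j <• z q k l = t • ∑ x, ∑ y, ∑ g, ∑ p,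
      (∑ e, ∑ a, ∑ b, braid q ν y g e a * (braid q ν x a b j * braid q ν b e p l)) •
        (z q i x * z q k y) • ω g p := by
    simp only [psi, Finset.smul_sum, Finset.sum_smul]
    simp only [← smul_comm (z q _ _) (MulOpposite.op (z q k l)),
      smul_comm (MulOpposite.op (z q k l)) (_ : ℂ), h _ _ k l, Finset.smul_sum,
      smul_comm (z q _ _) (_ : ℂ), smul_smul]
    simp only [← Fintype.sum_prod_type']
    refine Fintype.sum_equiv
      ⟨fun ⟨x, a, b, y, e, g, p⟩ => ⟨x, y, g, p, e, a, b⟩,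
        fun ⟨x, y, g, p, e, a, b⟩ => ⟨x, a, b, y, e, g, p⟩,
        fun _ => rfl, fun _ => rfl⟩ _ _ ?_
    rintro ⟨x, a, b, y, e, g, p⟩
    simp only [Equiv.coe_fn_mk]
    congr 1
    ring
  have h2 : psi q ν ω i j <• z q k l = t • ∑ b, ∑ a, braid q ν b a l j •
      ∑ d, (∑ x, ∑ y, braid q ν x y d b • (z q i x * z q k y)) •
        ∑ g, ∑ p, braid q ν d g p a • ω g p := by
    rw [h1]
    congr 1
    simp only [← braid_yang_baxter, Finset.smul_sum, Finset.sum_smul]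
    simp only [smul_comm (_ * _ : GLq q) (_ : ℂ), smul_assoc, smul_smul]
    simp only [← Fintype.sum_prod_type']
    refine Fintype.sum_equiv
      ⟨fun ⟨x, y, g, p, d, b, a⟩ => ⟨b, a, d, g, p, x, y⟩,
        fun ⟨b, a, d, g, p, x, y⟩ => ⟨x, y, g, p, d, b, a⟩,
        fun _ => rfl, fun _ => rfl⟩ _ _ ?_
    rintro ⟨x, y, g, p, d, b, a⟩
    simp only [Equiv.coe_fn_mk]
    congr 1
    ring
  rw [h2]
  congr 1
  simp only [isQuantumMatrix_z q ν i k _ _, sum_braid_smul_right q ν i k (fun n a => z q a _ * z q n _)]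
  have h3 : ∀ b a, ∑ d, (diagCoeff q ν i k • (z q k b * z q i d) + flipCoeff q ν i k • (z q i b * z q k d)) •
        ∑ g, ∑ p, braid q ν d g p a • ω g p =
      diagCoeff q ν i k • z q k b • psi q ν ω i a + flipCoeff q ν i k • z q i b • psi q ν ω k a := by
    intro b a
    simp only [add_smul, Finset.sum_add_distrib, smul_assoc, mul_smul, ← Finset.smul_sum, psi]
  simp only [h3]
  rw [sum_braid_smul_left q ν l j (fun b a => diagCoeff q ν i k • z q k b • psi q ν ω i a + flipCoeff q ν i k • z q i b • psi q ν ω k a)]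
  obtain ⟨f, hf⟩ : ∃ f : GLq q → M → M, ∀ a m, a • m = f a m := ⟨_, fun _ _ => rfl⟩
  simp only [hf]
  module

/-- The commutation relations between the `d z^i_j` and the generators, for all indices at once. -/
theorem IsBraided.commutator_z_mul_z (h : IsBraided q t ν ω) (hs : q - q⁻¹ ≠ 0) {D : GLq q → M}
    (hD : ∀ a, D a = (q - q⁻¹)⁻¹ • ((∑ i, ω i i) <• a - a • ∑ i, ω i i)) (i j k l : Fin 3) :
    D (z q i j) <• z q k l = (t - 1) • z q i j • D (z q k l) +
      t • (diagCoeff q ν i k • (diagCoeff q ν l j • z q k l • D (z q i j)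
          + flipCoeff q ν j l • z q k j • D (z q i l))
        + flipCoeff q ν i k • (diagCoeff q ν l j • z q i l • D (z q k j)
          + flipCoeff q ν j l • z q i j • D (z q k l)))
      + ((q - q⁻¹)⁻¹ * (t - 1)) • (z q i j * z q k l - t •
        (diagCoeff q ν i k • (diagCoeff q ν l j • (z q k l * z q i j)
          + flipCoeff q ν j l • (z q k j * z q i l))
        + flipCoeff q ν i k • (diagCoeff q ν l j • (z q i l * z q k j)
          + flipCoeff q ν j l • (z q i j * z q k l)))) • ∑ i, ω i i := by
  have hT : (∑ i, ω i i) <• z q k l = z q k l • (∑ i, ω i i) + (q - q⁻¹) • D (z q k l) := by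
    rw [hD, smul_smul, mul_inv_cancel₀ hs, one_smul, add_sub_cancel]
  have hψ : ∀ i j, D (z q i j) = ((q - q⁻¹)⁻¹ * (t - 1)) • z q i j • (∑ i, ω i i)
      + (sign ν * t) • psi q ν ω i j := fun i j => by rw [hD, h.commutator_z_eq_psi hs]
  have h1 : D (z q i j) <• z q k l = ((q - q⁻¹)⁻¹ * (t - 1)) • z q i j • ((∑ i, ω i i) <• z q k l)
      + (sign ν * t) • (psi q ν ω i j <• z q k l) := by
    rw [hψ, smul_add, smul_comm (MulOpposite.op (z q k l)) (_ : ℂ), smul_comm (MulOpposite.op (z q k l)) (_ : ℂ),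
      ← smul_comm (z q i j) (MulOpposite.op (z q k l))]
  have h2 : ∀ i j, (sign ν * t) • psi q ν ω i j =
      D (z q i j) - ((q - q⁻¹)⁻¹ * (t - 1)) • z q i j • (∑ i, ω i i) := fun i j => by
    rw [hψ, add_sub_cancel_left]
  have h3 : ∀ k l i j, (sign ν * t) • z q k l • psi q ν ω i j =
      z q k l • D (z q i j) - ((q - q⁻¹)⁻¹ * (t - 1)) • (z q k l * z q i j) • (∑ i, ω i i) := by
    intro k l i j
    rw [smul_comm, h2, smul_sub, smul_comm (z q k l) (_ : ℂ), mul_smul (z q k l)]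
  have h4 : (sign ν * t) • (psi q ν ω i j <• z q k l) = t •
      (diagCoeff q ν i k • (diagCoeff q ν l j • (sign ν * t) • z q k l • psi q ν ω i j
          + flipCoeff q ν j l • (sign ν * t) • z q k j • psi q ν ω i l)
        + flipCoeff q ν i k • (diagCoeff q ν l j • (sign ν * t) • z q i l • psi q ν ω k j
          + flipCoeff q ν j l • (sign ν * t) • z q i j • psi q ν ω k l)) := by
    rw [h.psi_mul_z]
    obtain ⟨f, hf⟩ : ∃ f : GLq q → M → M, ∀ a m, a • m = f a m := ⟨_, fun _ _ => rfl⟩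
    simp only [hf]
    module
  rw [h1, h4, hT]
  generalize q - q⁻¹ = s at hs h3 ⊢
  simp only [h3, smul_add, smul_sub, sub_smul, add_smul, smul_assoc, mul_smul (z q _ _) (z q _ _),
    smul_comm (z q _ _) (_ : ℂ)]
  obtain ⟨f, hf⟩ : ∃ f : GLq q → M → M, ∀ a m, a • m = f a m := ⟨_, fun _ _ => rfl⟩
  simp only [hf]
  match_scalars <;> field_simp
  ring

theorem IsBraided.isBasisFamily_commutator_z (h : IsBraided q t ν ω) (hs : q ^ 2 ≠ 1)
    (ht : t ≠ 0) (hc : traceCoeff q t ν ≠ 0)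
    (hω : IsBasisFamily (GLq q) fun p : Fin 3 × Fin 3 => ω p.1 p.2) {D : GLq q → M}
    (hD : ∀ a, D a = (q - q⁻¹)⁻¹ • ((∑ i, ω i i) <• a - a • ∑ i, ω i i)) :
    IsBasisFamily (GLq q) fun p : Fin 3 × Fin 3 => D (z q p.1 p.2) := by
  have hs' : q - q⁻¹ ≠ 0 := by
    intro h'; apply hs; field_simp [NeZero.ne q] at h'; simpa [sub_eq_zero] using h'
  obtain ⟨u, hu⟩ := isUnit_mcMatrix q t ν hs ht hc
  have h1 : IsBasisFamily (GLq q) fun p : Fin 3 × Fin 3 => mcForm q t ν ω p.1 p.2 := by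
    refine hω.of_matrix ((mcMatrix q t ν).map (algebraMap ℂ (GLq q)))
      ((↑u⁻¹ : Matrix _ _ ℂ).map (algebraMap ℂ (GLq q))) ?_ ?_ fun p => ?_
    · rw [← Matrix.map_mul, ← hu, Units.mul_inv, Matrix.map_one _ (map_zero _) (map_one _)]
    · rw [← Matrix.map_mul, ← hu, Units.inv_mul, Matrix.map_one _ (map_zero _) (map_one _)]
    · simp [mcForm_eq_sum_mcMatrix]
  have key : ∀ X Y : Fin 3 → Fin 3 → GLq q, (∀ i j, ∑ k, X i k * Y k j = if i = j then 1 else 0) →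
      (Matrix.of fun p r : Fin 3 × Fin 3 => X p.1 r.1 * if p.2 = r.2 then 1 else 0) *
        (Matrix.of fun p r : Fin 3 × Fin 3 => Y p.1 r.1 * if p.2 = r.2 then 1 else 0) = 1 := by
    intro X Y hXY
    ext ⟨i, j⟩ ⟨k, l⟩
    simp [Matrix.mul_apply, Fintype.sum_prod_type, Matrix.one_apply, hXY, ite_and]
    by_cases hjl : j = l <;> simp [hjl]
  refine h1.of_matrix _ _ (key _ _ (sum_z_mul_antipodeZ q)) (key _ _ (sum_antipodeZ_mul_z q))
    fun p => ?_
  rw [hD, h.commutator_z hs']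
  simp [Fintype.sum_prod_type]

theorem IsBraided.sum_antipodeZ_smul_commutator_z (h : IsBraided q t ν ω) (hs : q - q⁻¹ ≠ 0)
    {D : GLq q → M} (hD : ∀ a, D a = (q - q⁻¹)⁻¹ • ((∑ i, ω i i) <• a - a • ∑ i, ω i i))
    (i j : Fin 3) : ∑ k, antipodeZ q i k • D (z q k j) = mcForm q t ν ω i j := by
  simp only [hD, h.commutator_z hs]
  simp only [Finset.smul_sum, smul_smul]
  rw [Finset.sum_comm]
  simp [← Finset.sum_smul, sum_antipodeZ_mul_z]

end bimodule
end GLq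

namespace GLq

/-- The free left module `ι → A`, made into a bimodule by an algebra map `φ : A → M_ι(A)`. -/
def FreeBimodule {A ι : Type} [Ring A] [Algebra ℂ A] [Fintype ι] [DecidableEq ι]
    (_ : A →ₐ[ℂ] Matrix ι ι A) : Type := ι → A

namespace FreeBimodule
variable {A ι : Type} [Ring A] [Algebra ℂ A] [Fintype ι] [DecidableEq ι] (φ : A →ₐ[ℂ] Matrix ι ι A)

instance : AddCommGroup (FreeBimodule φ) := inferInstanceAs (AddCommGroup (ι → A))
instance : Module A (FreeBimodule φ) := inferInstanceAs (Module A (ι → A))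
instance : Module ℂ (FreeBimodule φ) := inferInstanceAs (Module ℂ (ι → A))
instance : IsScalarTower ℂ A (FreeBimodule φ) := inferInstanceAs (IsScalarTower ℂ A (ι → A))

instance : Module Aᵐᵒᵖ (FreeBimodule φ) where
  smul a v := Matrix.vecMul v (φ a.unop)
  one_smul v := by change Matrix.vecMul v (φ 1) = v; rw [map_one]; exact Matrix.vecMul_one (v : ι → A)
  mul_smul a b v := by
    change Matrix.vecMul v (φ (b.unop * a.unop)) = Matrix.vecMul (Matrix.vecMul v _) _
    rw [map_mul]; exact (Matrix.vecMul_vecMul (v : ι → A) _ _).symm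
  smul_zero a := Matrix.zero_vecMul _
  smul_add a v w := Matrix.add_vecMul _ _ _
  add_smul a b v := by
    change Matrix.vecMul v (φ (a.unop + b.unop)) = _
    rw [map_add]; exact Matrix.vecMul_add _ _ _
  zero_smul v := by
    change Matrix.vecMul v (φ 0) = _
    rw [map_zero]; exact Matrix.vecMul_zero _

theorem op_smul_def (a : Aᵐᵒᵖ) (v : FreeBimodule φ) :
    a • v = (Matrix.vecMul (v : ι → A) (φ a.unop) : ι → A) := rfl

instance : SMulCommClass A Aᵐᵒᵖ (FreeBimodule φ) where
  smul_comm a b v := (Matrix.smul_vecMul a (v : ι → A) (φ b.unop)).symm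

instance : IsScalarTower ℂ Aᵐᵒᵖ (FreeBimodule φ) where
  smul_assoc c a v := by
    change Matrix.vecMul (v : ι → A) (φ (c • a.unop)) = c • Matrix.vecMul (v : ι → A) (φ a.unop)
    rw [map_smul]; exact Matrix.vecMul_smul (v : ι → A) _ _

/-- The standard basis. -/
def std (i : ι) : FreeBimodule φ := (Pi.single i 1 : ι → A)

theorem isBasisFamily_std : IsBasisFamily A (std φ) := by
  have h : (std φ : ι → FreeBimodule φ) = (Pi.basisFun A ι : ι → (ι → A)) := by
    ext i; simp [std]; rfl
  constructor
  · rw [h]; exact (Pi.basisFun A ι).linearIndependent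
  · rw [h]; exact (Pi.basisFun A ι).span_eq

theorem std_op_smul (i : ι) (a : A) : std φ i <• a = ∑ j, φ a i j • std φ j := by
  have h1 : std φ i <• a = (fun j => φ a i j : ι → A) := by
    rw [op_smul_def, std, Matrix.single_one_vecMul]; rfl
  rw [h1]
  exact (pi_eq_sum_univ' (φ a i)).trans (by simp [std]; rfl)

end FreeBimodule

section action
variable (q : ℂ) [NeZero q] (ν : Bool) (t : ℂ)

/-- The algebra map `(id ⊗ f) Δ : A → M₃(A)` obtained from a representation `f`. -/
noncomputable def coactMap (f : GLq q →ₐ[ℂ] Matrix (Fin 3) (Fin 3) ℂ) :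
    GLq q →ₐ[ℂ] Matrix (Fin 3) (Fin 3) (GLq q) :=
  ((matrixEquivTensor (Fin 3) ℂ (GLq q)).symm.toAlgHom.comp
    (Algebra.TensorProduct.map (AlgHom.id ℂ (GLq q)) f)).comp (comul q)

theorem coactMap_z (f : GLq q →ₐ[ℂ] Matrix (Fin 3) (Fin 3) ℂ) (k l i a : Fin 3) :
    coactMap q f (z q k l) i a = ∑ d, f (z q d l) i a • z q k d := by
  simp [coactMap, comul_z, matrixEquivTensor_apply_symm, Matrix.sum_apply, Algebra.smul_def, Algebra.commutes]

omit [NeZero q] in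
theorem qdet_smul {B : Type*} [Ring B] [Algebra ℂ B] (x : Fin 3 → Fin 3 → B) :
    qdet q (fun i j => t • x i j) = t ^ 3 • qdet q x := by
  simp only [qdet, smul_mul_smul_comm]
  module

theorem twist_ne_zero : twist q ν ≠ 0 := by
  have hq : q ≠ 0 := NeZero.ne q
  cases ν <;> simp [twist, hq]

/-- The representation `z^d_l ↦ (K^{d a}_{l i})_{i a}`. -/
noncomputable def homA : GLq q →ₐ[ℂ] Matrix (Fin 3) (Fin 3) ℂ :=
  lift q (repA q ν) (isQuantumMatrix_repA q ν) ((twist q ν)⁻¹ • 1)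
    (by rw [qdet_repA, smul_mul_smul_comm, mul_inv_cancel₀ (twist_ne_zero q ν), one_smul, one_mul])
    (by rw [qdet_repA, smul_mul_smul_comm, inv_mul_cancel₀ (twist_ne_zero q ν), one_smul, one_mul])

/-- The representation `z^d_l ↦ t (K^{j d}_{b l})_{j b}`. -/
noncomputable def homB (ht : t ≠ 0) : GLq q →ₐ[ℂ] Matrix (Fin 3) (Fin 3) ℂ :=
  lift q _ ((isQuantumMatrix_repB q ν).smul t) ((t ^ 3 * twist q ν)⁻¹ • 1)
    (by rw [qdet_smul, qdet_repB, smul_smul, smul_mul_smul_comm,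
      mul_inv_cancel₀ (mul_ne_zero (pow_ne_zero 3 ht) (twist_ne_zero q ν)), one_smul, one_mul])
    (by rw [qdet_smul, qdet_repB, smul_smul, smul_mul_smul_comm,
      inv_mul_cancel₀ (mul_ne_zero (pow_ne_zero 3 ht) (twist_ne_zero q ν)), one_smul, one_mul])

variable {t}

/-- The right action of `Fun_q(GL(3,ℂ))` on the left-invariant forms of `Γ_ν(t)`. -/
noncomputable def braidAction (ht : t ≠ 0) :
    GLq q →ₐ[ℂ] Matrix (Fin 3 × Fin 3) (Fin 3 × Fin 3) (GLq q) :=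
  ((Matrix.compAlgEquiv (Fin 3) (Fin 3) (GLq q) ℂ).toAlgHom.comp
    (coactMap q (homA q ν)).mapMatrix).comp (coactMap q (homB q ν t ht))

theorem braidAction_z (ht : t ≠ 0) (k l i j a b : Fin 3) :
    braidAction q ν ht (z q k l) (j, i) (b, a) =
      ∑ d, ∑ e, (t * braid q ν d a e i * braid q ν j e b l) • z q k d := by
  have : braidAction q ν ht (z q k l) (j, i) (b, a) =
    coactMap q (homA q ν) (coactMap q (homB q ν t ht) (z q k l) j b) i a := rfl
  rw [this, coactMap_z, map_sum, Matrix.sum_apply, Finset.sum_comm]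
  refine Finset.sum_congr rfl fun e _ => ?_
  rw [map_smul, Matrix.smul_apply, coactMap_z, Finset.smul_sum]
  refine Finset.sum_congr rfl fun d _ => ?_
  rw [smul_smul, homA, homB, lift_z, lift_z]
  simp only [repA, repB, Matrix.smul_apply, Matrix.of_apply, smul_eq_mul]
  congr 1; ring

/-- The basis forms `ω_i^j` of `Γ_ν(t)`. -/
noncomputable def stdForm (ht : t ≠ 0) (i j : Fin 3) : FreeBimodule (braidAction q ν ht) :=
  FreeBimodule.std _ (j, i)

theorem isBraided_stdForm (ht : t ≠ 0) : IsBraided q t ν (stdForm q ν ht) := by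
  intro i j k l
  rw [stdForm, FreeBimodule.std_op_smul, Fintype.sum_prod_type]
  simp only [braidAction_z, Finset.sum_smul, smul_assoc, stdForm]
  simp only [← Fintype.sum_prod_type']
  refine Fintype.sum_equiv
      ⟨fun ⟨b, a, d, e⟩ => ⟨d, e, a, b⟩, fun ⟨d, e, a, b⟩ => ⟨b, a, d, e⟩,
        fun _ => rfl, fun _ => rfl⟩ _ _ ?_
  rintro ⟨b, a, d, e⟩
  simp only [Equiv.coe_fn_mk]

theorem isBasisFamily_stdForm (ht : t ≠ 0) :
    IsBasisFamily (GLq q) fun p : Fin 3 × Fin 3 => stdForm q ν ht p.1 p.2 := by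
  have h := FreeBimodule.isBasisFamily_std (braidAction q ν ht)
  have e : (fun p : Fin 3 × Fin 3 => stdForm q ν ht p.1 p.2) =
      FreeBimodule.std (braidAction q ν ht) ∘ Equiv.prodComm (Fin 3) (Fin 3) := rfl
  refine ⟨?_, ?_⟩
  · rw [e]; exact h.1.comp _ (Equiv.injective _)
  · rw [e, (Equiv.surjective _).range_comp]; exact h.2

end action
end GLq

namespace FirstOrderCalculus
open GLq

/-- The common form of `IsGamma1` and `IsGamma2`. -/
def IsGamma {q : ℂ} (C : FirstOrderCalculus (GLq q)) (t : ℂ) (ν : Bool) : Prop :=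
  ∃ ω : Fin 3 → Fin 3 → C.Form, C.IsLeftBasis ω ∧ IsBraided q t ν ω ∧ C.IsInnerBy ω

theorem isGamma1_iff {q : ℂ} [NeZero q] (C : FirstOrderCalculus (GLq q)) (t : ℂ) :
    C.IsGamma1 t ↔ C.IsGamma t false := by
  simp only [IsGamma1, IsGamma, IsBraided, Rmat_inv_eq_braid]

theorem isGamma2_iff {q : ℂ} [NeZero q] (C : FirstOrderCalculus (GLq q)) (t : ℂ) :
    C.IsGamma2 t ↔ C.IsGamma t true := by
  simp only [IsGamma2, IsGamma, IsBraided, Rmat_eq_braid]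

section inner
variable {A : Type} [Ring A] [Algebra ℂ A] {M : Type} [AddCommGroup M] [Module ℂ M] [Module A M]
  [Module Aᵐᵒᵖ M] [SMulCommClass A Aᵐᵒᵖ M] [IsScalarTower ℂ A M] [IsScalarTower ℂ Aᵐᵒᵖ M]

/-- The calculus on a bimodule `M` defined by an inner derivation. -/
noncomputable def ofInner (c : ℂ) (T : M)
    (h : Submodule.span A (Set.range fun a : A => c • (T <• a - a • T)) = ⊤) :
    FirstOrderCalculus A where
  Form := M
  d :=
    { toFun := fun a => c • (T <• a - a • T)
      map_add' := fun a b => by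
        simp only [MulOpposite.op_add, add_smul, ← smul_add]; congr 1; abel
      map_smul' := fun s a => by
        simp only [MulOpposite.op_smul, smul_assoc, RingHom.id_apply, ← smul_sub]
        rw [smul_comm] }
  leibniz a b := by
    change c • (T <• (a * b) - (a * b) • T) = (c • (T <• a - a • T)) <• b + a • c • (T <• b - b • T)
    rw [smul_comm (MulOpposite.op b) c, smul_comm a c, ← smul_add]
    congr 1
    rw [MulOpposite.op_mul, mul_smul, mul_smul, smul_sub, smul_sub, smul_comm a (MulOpposite.op b)]
    abel
  span_range_d := h

end inner

theorem exists_isGamma {q : ℂ} [NeZero q] {t : ℂ} {ν : Bool} (hs : q ^ 2 ≠ 1) (ht : t ≠ 0)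
    (hc : traceCoeff q t ν ≠ 0) : ∃ C : FirstOrderCalculus (GLq q), C.IsGamma t ν := by
  have h := (isBraided_stdForm q ν ht).isBasisFamily_commutator_z hs ht hc
    (isBasisFamily_stdForm q ν ht) (D := _) (fun a => rfl)
  refine ⟨ofInner (q - q⁻¹)⁻¹ (∑ i, stdForm q ν ht i i) ?_, stdForm q ν ht,
    isBasisFamily_stdForm q ν ht, isBraided_stdForm q ν ht, fun a => rfl⟩
  rw [eq_top_iff, ← h.2]
  refine Submodule.span_mono ?_
  rintro _ ⟨p, rfl⟩
  exact ⟨_, rfl⟩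

end FirstOrderCalculus

theorem op_algebraMap_smul {A M : Type*} [Ring A] [Algebra ℂ A] [AddCommGroup M] [Module ℂ M]
    [Module Aᵐᵒᵖ M] [IsScalarTower ℂ Aᵐᵒᵖ M] (c : ℂ) (m : M) : m <• algebraMap ℂ A c = c • m :=
  algebraMap_smul Aᵐᵒᵖ c m

/-- A left-linear map prescribed on a basis, where the left action on the target is given by an
algebra map-like family `l`. -/
theorem IsBasisFamily.exists_extension {A M N ι : Type*} [Ring A] [Algebra ℂ A] [AddCommGroup M]
    [Module ℂ M] [Module A M] [IsScalarTower ℂ A M] [AddCommGroup N] [Module ℂ N] [Fintype ι]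
    {v : ι → M} (hv : IsBasisFamily A v) (l : A →ₗ[ℂ] N →ₗ[ℂ] N) (h1 : ∀ n, l 1 n = n)
    (hl : ∀ a b n, l (a * b) n = l a (l b n)) (w : ι → N) :
    ∃ Φ : M →ₗ[ℂ] N, (∀ a m, Φ (a • m) = l a (Φ m)) ∧ ∀ i, Φ (v i) = w i := by
  classical
  let b : Module.Basis ι A M := Module.Basis.mk hv.1 hv.2.ge
  let Φ : M →ₗ[ℂ] N := ∑ i, (l.flip (w i)).comp ((b.coord i).restrictScalars ℂ)
  have hΦ : ∀ m, Φ m = ∑ i, l (b.repr m i) (w i) := fun m => by simp [Φ, LinearMap.sum_apply]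
  refine ⟨Φ, fun a m => ?_, fun i => ?_⟩
  · simp [hΦ, hl]
  · have : v i = b i := by simp [b]
    rw [hΦ, this, Finset.sum_eq_single i]
    · simp [h1]
    · intro j _ hj; simp [hj.symm]
    · simp

namespace GLq
variable {q : ℂ}

/-- A map out of a bimodule that intertwines the left actions also intertwines the right actions
if it does so for the right multiplication of a left generating family by the generators. -/
theorem right_equivariant {M N ι : Type*} [AddCommGroup M] [Module ℂ M] [Module (GLq q) M]
    [Module (GLq q)ᵐᵒᵖ M] [SMulCommClass (GLq q) (GLq q)ᵐᵒᵖ M] [IsScalarTower ℂ (GLq q) M]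
    [IsScalarTower ℂ (GLq q)ᵐᵒᵖ M] [AddCommGroup N] [Module ℂ N] {v : ι → M}
    (hv : Submodule.span (GLq q) (Set.range v) = ⊤) (Φ : M →ₗ[ℂ] N) (l r : GLq q → N → N)
    (hr : ∀ a n n', r a (n + n') = r a n + r a n') (hr0 : ∀ a, r a 0 = 0)
    (hra : ∀ a b n, r (a + b) n = r a n + r b n) (hrm : ∀ a b n, r (a * b) n = r b (r a n))
    (hrc : ∀ (c : ℂ) n, r (algebraMap ℂ _ c) n = c • n) (hlr : ∀ a b n, l a (r b n) = r b (l a n))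
    (hΦ : ∀ a m, Φ (a • m) = l a (Φ m))
    (hz : ∀ i k j, Φ (v i <• z q k j) = r (z q k j) (Φ (v i))) (a : GLq q) (m : M) :
    Φ (m <• a) = r a (Φ m) := by
  revert m
  induction a using induction_on with
  | hc c => intro m; rw [op_algebraMap_smul, hrc, map_smul]
  | hz k j =>
    intro m
    have hm : m ∈ Submodule.span (GLq q) (Set.range v) := hv ▸ Submodule.mem_top
    induction hm using Submodule.span_induction with
    | mem x hx => obtain ⟨i, rfl⟩ := hx; exact hz i k j
    | zero => rw [smul_zero, map_zero, hr0]
    | add x y _ _ hx hy => rw [smul_add, map_add, map_add, hr, hx, hy]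
    | smul a x _ hx => rw [← smul_comm a, hΦ, hx, hΦ, hlr]
  | hadd a b ha hb => intro m; rw [MulOpposite.op_add, add_smul, map_add, ha, hb, hra]
  | hmul a b ha hb => intro m; rw [MulOpposite.op_mul, mul_smul, hb, ha, hrm]
  | hinv h =>
    intro m
    have h1 : ∀ n, r 1 n = n := fun n => by rw [← map_one (algebraMap ℂ (GLq q)), hrc, one_smul]
    have h2 : m = (m <• detInv q) <• qdet q (z q) := by
      rw [← mul_smul, ← MulOpposite.op_mul, detInv_mul_qdet, MulOpposite.op_one, one_smul]
    conv_rhs => rw [h2, h, ← hrm, qdet_mul_detInv, h1]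

end GLq

namespace FirstOrderCalculus
open GLq
variable {q : ℂ}

theorem d_algebraMap {A : Type} [Ring A] [Algebra ℂ A] (C : FirstOrderCalculus A) (c : ℂ) :
    C.d (algebraMap ℂ A c) = 0 := by
  have h : C.d 1 = 0 := by
    have := C.leibniz 1 1
    rw [mul_one, MulOpposite.op_one, one_smul, one_smul] at this
    simpa using this
  rw [Algebra.algebraMap_eq_smul_one, map_smul, h, smul_zero]

theorem d_detInv (C : FirstOrderCalculus (GLq q)) :
    C.d (detInv q) = -(detInv q • (C.d (qdet q (z q)) <• detInv q)) := by
  have h1 : C.d (qdet q (z q)) <• detInv q + qdet q (z q) • C.d (detInv q) = 0 := by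
    rw [← C.leibniz, qdet_mul_detInv, ← map_one (algebraMap ℂ (GLq q)), d_algebraMap]
  have h2 := congrArg (detInv q • ·) h1
  simp only [smul_add, smul_smul, detInv_mul_qdet, one_smul, smul_zero] at h2
  exact eq_neg_of_add_eq_zero_right h2

/-- A left-linear isomorphism is an equivalence of calculi if it is compatible with the right
multiplication by generators on a left generating family and with the differentials of the
generators. -/
theorem equivalent_of_generators {ι : Type*} {C C' : FirstOrderCalculus (GLq q)}
    (ζ : C.Form ≃ₗ[GLq q] C'.Form) {v : ι → C.Form}
    (hv : Submodule.span (GLq q) (Set.range v) = ⊤)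
    (hz : ∀ i k j, ζ (v i <• z q k j) = ζ (v i) <• z q k j)
    (hd : ∀ i j, ζ (C.d (z q i j)) = C'.d (z q i j)) : C.Equivalent C' := by
  have hr : ∀ (ρ : C.Form) (a : GLq q), ζ (ρ <• a) = ζ ρ <• a := fun ρ a =>
    right_equivariant hv (ζ.toLinearMap.restrictScalars ℂ) (fun a n => a • n) (fun a n => n <• a)
      (fun a => smul_add _) (fun a => smul_zero _)
      (fun a b n => by rw [MulOpposite.op_add, add_smul])
      (fun a b n => by rw [MulOpposite.op_mul, mul_smul]) (fun c n => op_algebraMap_smul c n)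
      (fun a b n => smul_comm _ _ _) (fun a m => map_smul ζ a m) hz a ρ
  refine ⟨ζ, hr, fun a => ?_⟩
  induction a using induction_on with
  | hc c => rw [d_algebraMap, d_algebraMap, map_zero]
  | hz i j => exact hd i j
  | hadd a b ha hb => rw [map_add, map_add, map_add, ha, hb]
  | hmul a b ha hb => rw [leibniz, leibniz, map_add, hr, map_smul ζ, ha, hb]
  | hinv h => rw [d_detInv, d_detInv, map_neg, map_smul ζ, hr, h]

/-- The left-linear isomorphism matching two bases. -/
theorem exists_linearEquiv {A M N ι : Type*} [Ring A] [AddCommGroup M] [Module A M]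
    [AddCommGroup N] [Module A N] {v : ι → M} {w : ι → N} (hv : IsBasisFamily A v)
    (hw : IsBasisFamily A w) : ∃ ζ : M ≃ₗ[A] N, ∀ i, ζ (v i) = w i := by
  refine ⟨(Module.Basis.mk hv.1 hv.2.ge).equiv (Module.Basis.mk hw.1 hw.2.ge) (Equiv.refl ι), fun i => ?_⟩
  have : v i = Module.Basis.mk hv.1 hv.2.ge i := by simp
  rw [this, Module.Basis.equiv_apply]; simp

theorem IsGamma.equivalent [NeZero q] {t : ℂ} {ν : Bool} (hs : q - q⁻¹ ≠ 0)
    {C C' : FirstOrderCalculus (GLq q)} (h : C.IsGamma t ν) (h' : C'.IsGamma t ν) :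
    C.Equivalent C' := by
  obtain ⟨ω, hb, hω, hd⟩ := h
  obtain ⟨ω', hb', hω', hd'⟩ := h'
  obtain ⟨ζ, hζ⟩ := exists_linearEquiv hb hb'
  have hζ' : ∀ i j, ζ (ω i j) = ω' i j := fun i j => hζ (i, j)
  have hc : ∀ (c : ℂ) m, ζ (c • m) = c • ζ m := fun c m => (ζ.toLinearMap.restrictScalars ℂ).map_smul c m
  refine equivalent_of_generators ζ hb.2 (fun p k l => ?_) fun i j => ?_
  · simp only [hζ', hω _ _ k l, hω' _ _ k l, map_sum, hc, map_smul]
  · rw [hd, hd', hω.commutator_z hs, hω'.commutator_z hs]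
    simp only [mcForm, map_sum, map_smul, map_add, hc, hζ']

theorem Equivalent.isGamma {t : ℂ} {ν : Bool} {C C' : FirstOrderCalculus (GLq q)}
    (e : C.Equivalent C') (h : C.IsGamma t ν) : C'.IsGamma t ν := by
  obtain ⟨ω, hb, hω, hd⟩ := h
  obtain ⟨ζ, hr, hζ⟩ := e
  have hc : ∀ (c : ℂ) m, ζ (c • m) = c • ζ m := fun c m => (ζ.toLinearMap.restrictScalars ℂ).map_smul c m
  refine ⟨fun i j => ζ (ω i j), ⟨?_, ?_⟩, fun i j k l => ?_, fun a => ?_⟩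
  · exact hb.1.map' ζ.toLinearMap ζ.ker
  · have := congrArg (Submodule.map ζ.toLinearMap) hb.2
    rw [Submodule.map_span, ← Set.range_comp, Submodule.map_top, ζ.range] at this
    exact this
  · rw [← hr, hω]
    simp only [map_sum, hc, map_smul]
  · rw [← hζ, hd, hc, map_sub, hr, map_smul, map_sum]

end FirstOrderCalculus

namespace GLq
section
variable (q : ℂ) [NeZero q] (ν : Bool)

theorem braid_antipodeZ (j n h l : Fin 3) :
    ∑ e, ∑ b, braid q ν j e b l • (z q n e * antipodeZ q b h) =
      ∑ b, ∑ e, braid q ν b n h e • (antipodeZ q j b * z q e l) := by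
  have h1 : ∀ g, ∑ a, braid q ν j a g l • z q n a =
      ∑ c, ∑ p, ∑ a, braid q ν c n p a • (antipodeZ q j c * z q a l * z q p g) := by
    intro g
    have h2 : ∀ c, antipodeZ q j c * ∑ d, ∑ a, braid q ν d a g l • (z q c d * z q n a) =
        antipodeZ q j c * ∑ p, ∑ a, braid q ν c n p a • (z q a l * z q p g) := fun c => by
      rw [isQuantumMatrix_z q ν c n g l]
    have h3 := Finset.sum_congr rfl fun c (_ : c ∈ Finset.univ) => h2 c
    simp only [Finset.mul_sum, mul_smul_comm, ← mul_assoc] at h3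
    rw [← h3, Finset.sum_comm]
    have h4 : ∀ d, ∑ c, ∑ a, braid q ν d a g l • (antipodeZ q j c * z q c d * z q n a) =
        ∑ a, braid q ν d a g l • ((if j = d then 1 else 0) * z q n a) := fun d => by
      rw [Finset.sum_comm]
      simp only [← Finset.smul_sum, ← Finset.sum_mul, sum_antipodeZ_mul_z]
    simp only [h4]
    symm
    rw [Finset.sum_eq_single j]
    · simp
    · intro b _ hb; simp [hb.symm]
    · simp
  have h5 : ∑ e, ∑ b, braid q ν j e b l • (z q n e * antipodeZ q b h) =
      ∑ b, (∑ e, braid q ν j e b l • z q n e) * antipodeZ q b h := by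
    rw [Finset.sum_comm]; simp only [Finset.sum_mul, smul_mul_assoc]
  rw [h5]
  simp only [h1, Finset.sum_mul, smul_mul_assoc]
  rw [Finset.sum_comm]
  refine Finset.sum_congr rfl fun c _ => ?_
  have h6 : ∀ p, ∑ b, ∑ a, braid q ν c n p a • (antipodeZ q j c * z q a l * z q p b * antipodeZ q b h) =
      ∑ a, braid q ν c n p a • (antipodeZ q j c * z q a l * if p = h then 1 else 0) := fun p => by
    rw [Finset.sum_comm]
    simp only [mul_assoc, ← Finset.smul_sum, ← Finset.mul_sum, sum_z_mul_antipodeZ]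
  rw [Finset.sum_comm]
  simp only [h6]
  rw [Finset.sum_eq_single h]
  · simp
  · intro b _ hb; simp [hb]
  · simp

/-- The adjoint coaction is compatible with the right multiplication of the basis forms. -/
theorem braid_adjoint (m g h i j l : Fin 3) :
    ∑ d, ∑ e, ∑ a, ∑ b, (braid q ν d a e i * braid q ν j e b l) •
        (z q m d * (z q g a * antipodeZ q b h)) =
      ∑ n, ∑ a, ∑ b, ∑ e, (braid q ν m g e a * braid q ν b e h n) •
        (z q a i * antipodeZ q j b * z q n l) := by
  have h1 : ∑ d, ∑ e, ∑ a, ∑ b, (braid q ν d a e i * braid q ν j e b l) •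
        (z q m d * (z q g a * antipodeZ q b h)) =
      ∑ e, ∑ b, braid q ν j e b l • ((∑ d, ∑ a, braid q ν d a e i • (z q m d * z q g a)) *
        antipodeZ q b h) := by
    simp only [Finset.sum_mul, Finset.smul_sum, smul_mul_assoc, smul_smul, mul_assoc]
    simp only [← Fintype.sum_prod_type']
    refine Fintype.sum_equiv
      ⟨fun ⟨d, e, a, b⟩ => ⟨e, b, d, a⟩, fun ⟨e, b, d, a⟩ => ⟨d, e, a, b⟩,
        fun _ => rfl, fun _ => rfl⟩ _ _ ?_
    rintro ⟨d, e, a, b⟩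
    simp only [Equiv.coe_fn_mk, mul_comm]
  have h2 : ∑ e, ∑ b, braid q ν j e b l • ((∑ n, ∑ a, braid q ν m g n a • (z q a i * z q n e)) *
        antipodeZ q b h) = ∑ n, ∑ a, braid q ν m g n a • (z q a i *
          ∑ e, ∑ b, braid q ν j e b l • (z q n e * antipodeZ q b h)) := by
    simp only [Finset.sum_mul, Finset.mul_sum, Finset.smul_sum, smul_mul_assoc, mul_smul_comm,
      smul_smul, mul_assoc]
    simp only [← Fintype.sum_prod_type']
    refine Fintype.sum_equiv
      ⟨fun ⟨e, b, n, a⟩ => ⟨n, a, e, b⟩, fun ⟨n, a, e, b⟩ => ⟨e, b, n, a⟩,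
        fun _ => rfl, fun _ => rfl⟩ _ _ ?_
    rintro ⟨e, b, n, a⟩
    simp only [Equiv.coe_fn_mk, mul_comm]
  rw [h1]
  simp only [isQuantumMatrix_z q ν m g _ i]
  rw [h2]
  simp only [braid_antipodeZ]
  simp only [Finset.mul_sum, Finset.smul_sum, mul_smul_comm,
      smul_smul, mul_assoc]
  simp only [← Fintype.sum_prod_type']
  refine Fintype.sum_equiv
      ⟨fun ⟨e, a, b, n⟩ => ⟨n, a, b, e⟩, fun ⟨n, a, b, e⟩ => ⟨e, a, b, n⟩,
        fun _ => rfl, fun _ => rfl⟩ _ _ ?_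
  rintro ⟨e, a, b, n⟩
  simp only [Equiv.coe_fn_mk]

end
end GLq

namespace FirstOrderCalculus
open GLq

section tensor
variable {A : Type} [Ring A] [Algebra ℂ A] (C : FirstOrderCalculus A)

/-- Right multiplication on `Form` as a linear map. -/
def rsmul : A →ₗ[ℂ] C.Form →ₗ[ℂ] C.Form :=
  LinearMap.mk₂ ℂ (fun a ρ => ρ <• a) (fun a b ρ => by rw [MulOpposite.op_add, add_smul])
    (fun c a ρ => by rw [MulOpposite.op_smul, smul_assoc]) (fun a ρ ρ' => smul_add _ _ _)
    (fun c a ρ => smul_comm _ _ _)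

/-- The right action of `A ⊗ A` on `A ⊗ Form`. -/
noncomputable def ractL : A ⊗[ℂ] A →ₗ[ℂ] A ⊗[ℂ] C.Form →ₗ[ℂ] A ⊗[ℂ] C.Form :=
  TensorProduct.map₂ (LinearMap.mul ℂ A).flip C.rsmul

/-- The right action of `A ⊗ A` on `Form ⊗ A`. -/
noncomputable def ractR : A ⊗[ℂ] A →ₗ[ℂ] C.Form ⊗[ℂ] A →ₗ[ℂ] C.Form ⊗[ℂ] A :=
  TensorProduct.map₂ C.rsmul (LinearMap.mul ℂ A).flip

theorem actL_tmul (a b c : A) (ρ : C.Form) : C.actL (a ⊗ₜ b) (c ⊗ₜ ρ) = (a * c) ⊗ₜ (b • ρ) := rfl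
theorem actR_tmul (a b c : A) (ρ : C.Form) : C.actR (a ⊗ₜ b) (ρ ⊗ₜ c) = (a • ρ) ⊗ₜ (b * c) := rfl
theorem ractL_tmul (a b c : A) (ρ : C.Form) : C.ractL (a ⊗ₜ b) (c ⊗ₜ ρ) = (c * a) ⊗ₜ (ρ <• b) := rfl
theorem ractR_tmul (a b c : A) (ρ : C.Form) : C.ractR (a ⊗ₜ b) (ρ ⊗ₜ c) = (ρ <• a) ⊗ₜ (c * b) := rfl

theorem actL_mul (x y : A ⊗[ℂ] A) (w : A ⊗[ℂ] C.Form) : C.actL (x * y) w = C.actL x (C.actL y w) := by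
  induction x with
  | zero => simp
  | add x x' hx hx' => simp only [add_mul, map_add, LinearMap.add_apply, hx, hx']
  | tmul a b =>
    induction y with
    | zero => simp
    | add y y' hy hy' => simp only [mul_add, map_add, LinearMap.add_apply, hy, hy']
    | tmul a' b' =>
      induction w with
      | zero => simp
      | add w w' hw hw' => simp only [map_add, hw, hw']
      | tmul c ρ => simp only [Algebra.TensorProduct.tmul_mul_tmul, actL_tmul, mul_assoc, mul_smul]

theorem actR_mul (x y : A ⊗[ℂ] A) (w : C.Form ⊗[ℂ] A) : C.actR (x * y) w = C.actR x (C.actR y w) := by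
  induction x with
  | zero => simp
  | add x x' hx hx' => simp only [add_mul, map_add, LinearMap.add_apply, hx, hx']
  | tmul a b =>
    induction y with
    | zero => simp
    | add y y' hy hy' => simp only [mul_add, map_add, LinearMap.add_apply, hy, hy']
    | tmul a' b' =>
      induction w with
      | zero => simp
      | add w w' hw hw' => simp only [map_add, hw, hw']
      | tmul c ρ => simp only [Algebra.TensorProduct.tmul_mul_tmul, actR_tmul, mul_assoc, mul_smul]

theorem ractL_mul (x y : A ⊗[ℂ] A) (w : A ⊗[ℂ] C.Form) :
    C.ractL (x * y) w = C.ractL y (C.ractL x w) := by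
  induction x with
  | zero => simp
  | add x x' hx hx' => simp only [add_mul, map_add, LinearMap.add_apply, hx, hx']
  | tmul a b =>
    induction y with
    | zero => simp
    | add y y' hy hy' => simp only [mul_add, map_add, LinearMap.add_apply, hy, hy']
    | tmul a' b' =>
      induction w with
      | zero => simp
      | add w w' hw hw' => simp only [map_add, hw, hw']
      | tmul c ρ =>
        simp only [Algebra.TensorProduct.tmul_mul_tmul, ractL_tmul, mul_assoc, MulOpposite.op_mul, mul_smul]

theorem ractR_mul (x y : A ⊗[ℂ] A) (w : C.Form ⊗[ℂ] A) :
    C.ractR (x * y) w = C.ractR y (C.ractR x w) := by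
  induction x with
  | zero => simp
  | add x x' hx hx' => simp only [add_mul, map_add, LinearMap.add_apply, hx, hx']
  | tmul a b =>
    induction y with
    | zero => simp
    | add y y' hy hy' => simp only [mul_add, map_add, LinearMap.add_apply, hy, hy']
    | tmul a' b' =>
      induction w with
      | zero => simp
      | add w w' hw hw' => simp only [map_add, hw, hw']
      | tmul c ρ =>
        simp only [Algebra.TensorProduct.tmul_mul_tmul, ractR_tmul, mul_assoc, MulOpposite.op_mul, mul_smul]

theorem actL_ractL (x y : A ⊗[ℂ] A) (w : A ⊗[ℂ] C.Form) :
    C.actL x (C.ractL y w) = C.ractL y (C.actL x w) := by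
  induction x with
  | zero => simp
  | add x x' hx hx' => simp only [map_add, LinearMap.add_apply, hx, hx']
  | tmul a b =>
    induction y with
    | zero => simp
    | add y y' hy hy' => simp only [map_add, LinearMap.add_apply, hy, hy']
    | tmul a' b' =>
      induction w with
      | zero => simp
      | add w w' hw hw' => simp only [map_add, hw, hw']
      | tmul c ρ => simp only [actL_tmul, ractL_tmul, mul_assoc, smul_comm b (MulOpposite.op b')]

theorem actR_ractR (x y : A ⊗[ℂ] A) (w : C.Form ⊗[ℂ] A) :
    C.actR x (C.ractR y w) = C.ractR y (C.actR x w) := by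
  induction x with
  | zero => simp
  | add x x' hx hx' => simp only [map_add, LinearMap.add_apply, hx, hx']
  | tmul a b =>
    induction y with
    | zero => simp
    | add y y' hy hy' => simp only [map_add, LinearMap.add_apply, hy, hy']
    | tmul a' b' =>
      induction w with
      | zero => simp
      | add w w' hw hw' => simp only [map_add, hw, hw']
      | tmul c ρ => simp only [actR_tmul, ractR_tmul, mul_assoc, smul_comm a (MulOpposite.op a')]

theorem actL_one (w : A ⊗[ℂ] C.Form) : C.actL 1 w = w := by
  induction w with
  | zero => simp
  | add w w' hw hw' => simp only [map_add, hw, hw']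
  | tmul c ρ => rw [Algebra.TensorProduct.one_def, actL_tmul, one_mul, one_smul]

theorem actR_one (w : C.Form ⊗[ℂ] A) : C.actR 1 w = w := by
  induction w with
  | zero => simp
  | add w w' hw hw' => simp only [map_add, hw, hw']
  | tmul c ρ => rw [Algebra.TensorProduct.one_def, actR_tmul, one_mul, one_smul]

theorem ractL_one (w : A ⊗[ℂ] C.Form) : C.ractL 1 w = w := by
  induction w with
  | zero => simp
  | add w w' hw hw' => simp only [map_add, hw, hw']
  | tmul c ρ => rw [Algebra.TensorProduct.one_def, ractL_tmul, mul_one, MulOpposite.op_one, one_smul]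

theorem ractR_one (w : C.Form ⊗[ℂ] A) : C.ractR 1 w = w := by
  induction w with
  | zero => simp
  | add w w' hw hw' => simp only [map_add, hw, hw']
  | tmul c ρ => rw [Algebra.TensorProduct.one_def, ractR_tmul, mul_one, MulOpposite.op_one, one_smul]

variable {C}

theorem map_id_d_of_inner {c : ℂ} {T : C.Form} (h : ∀ a, C.d a = c • (T <• a - a • T))
    (x : A ⊗[ℂ] A) : TensorProduct.map LinearMap.id C.d x =
      c • (C.ractL x (1 ⊗ₜ T) - C.actL x (1 ⊗ₜ T)) := by
  induction x with
  | zero => simp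
  | add x y hx hy => simp only [map_add, hx, hy, LinearMap.add_apply]; module
  | tmul a b =>
    rw [TensorProduct.map_tmul, ractL_tmul, actL_tmul, h, one_mul, mul_one, ← TensorProduct.tmul_sub,
      TensorProduct.tmul_smul, LinearMap.id_apply]

theorem map_d_id_of_inner {c : ℂ} {T : C.Form} (h : ∀ a, C.d a = c • (T <• a - a • T))
    (x : A ⊗[ℂ] A) : TensorProduct.map C.d LinearMap.id x =
      c • (C.ractR x (T ⊗ₜ 1) - C.actR x (T ⊗ₜ 1)) := by
  induction x with
  | zero => simp
  | add x y hx hy => simp only [map_add, hx, hy, LinearMap.add_apply]; module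
  | tmul a b =>
    rw [TensorProduct.map_tmul, ractR_tmul, actR_tmul, h, one_mul, mul_one, ← TensorProduct.sub_tmul,
      TensorProduct.smul_tmul', LinearMap.id_apply]

end tensor

section bicovariant
variable {q : ℂ} [NeZero q] {t : ℂ} {ν : Bool} {C : FirstOrderCalculus (GLq q)}

theorem IsGamma.exists_left_coaction (h : C.IsGamma t ν) :
    ∃ ΔL : C.Form →ₗ[ℂ] GLq q ⊗[ℂ] C.Form, ∀ a b : GLq q, ΔL (a • C.d b) =
      C.actL (comul q a) (TensorProduct.map LinearMap.id C.d (comul q b)) := by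
  obtain ⟨ω, hb, hω, hd⟩ := h
  obtain ⟨Φ, hΦ, hw⟩ := IsBasisFamily.exists_extension (A := GLq q) hb
    (C.actL.comp (comul q).toLinearMap) (fun n => by simpa using C.actL_one n)
    (fun a b n => by simpa using C.actL_mul _ _ n) (fun p => (1 : GLq q) ⊗ₜ[ℂ] ω p.1 p.2)
  have hw' : ∀ i j, Φ (ω i j) = 1 ⊗ₜ ω i j := fun i j => hw (i, j)
  have hΦ' : ∀ a m, Φ (a • m) = C.actL (comul q a) (Φ m) := hΦ
  have hr := right_equivariant hb.2 Φ (fun a n => C.actL (comul q a) n)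
    (fun a n => C.ractL (comul q a) n)
    (fun a => map_add _) (fun a => map_zero _) (fun a b n => by simp)
    (fun a b n => by rw [map_mul, ractL_mul])
    (fun c n => by rw [AlgHom.commutes, Algebra.algebraMap_eq_smul_one, map_smul, LinearMap.smul_apply, ractL_one])
    (fun a b n => C.actL_ractL _ _ n) hΦ' (fun p k l => by
      simp only [hω _ _ _ l, map_sum, map_smul, hΦ', hw', comul_z, LinearMap.sum_apply, actL_tmul, ractL_tmul,
        mul_one, one_mul, TensorProduct.tmul_sum, TensorProduct.tmul_smul, Finset.smul_sum]
      simp only [← Fintype.sum_prod_type']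
      refine Fintype.sum_equiv
        ⟨fun ⟨d, e, a, b, m⟩ => ⟨m, d, e, a, b⟩, fun ⟨m, d, e, a, b⟩ => ⟨d, e, a, b, m⟩,
          fun _ => rfl, fun _ => rfl⟩ _ _ ?_
      rintro ⟨d, e, a, b, m⟩
      simp only [Equiv.coe_fn_mk])
  refine ⟨Φ, fun a b => ?_⟩
  have hT : Φ (∑ i, ω i i) = 1 ⊗ₜ ∑ i, ω i i := by rw [map_sum, TensorProduct.tmul_sum]; simp only [hw']
  rw [hΦ', hd, map_smul, map_sub, hr, hΦ', hT, map_id_d_of_inner hd]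

theorem IsGamma.exists_right_coaction (h : C.IsGamma t ν) :
    ∃ ΔR : C.Form →ₗ[ℂ] C.Form ⊗[ℂ] GLq q, ∀ a b : GLq q, ΔR (a • C.d b) =
      C.actR (comul q a) (TensorProduct.map C.d LinearMap.id (comul q b)) := by
  obtain ⟨ω, hb, hω, hd⟩ := h
  obtain ⟨Φ, hΦ, hw⟩ := IsBasisFamily.exists_extension (A := GLq q) hb
    (C.actR.comp (comul q).toLinearMap) (fun n => by simpa using C.actR_one n)
    (fun a b n => by simpa using C.actR_mul _ _ n)
    (fun p => ∑ a, ∑ b, ω a b ⊗ₜ[ℂ] (z q a p.1 * antipodeZ q p.2 b))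
  have hw' : ∀ i j, Φ (ω i j) = ∑ a, ∑ b, ω a b ⊗ₜ[ℂ] (z q a i * antipodeZ q j b) :=
    fun i j => hw (i, j)
  have hΦ' : ∀ a m, Φ (a • m) = C.actR (comul q a) (Φ m) := hΦ
  have hr := right_equivariant hb.2 Φ (fun a n => C.actR (comul q a) n)
    (fun a n => C.ractR (comul q a) n)
    (fun a => map_add _) (fun a => map_zero _) (fun a b n => by simp)
    (fun a b n => by rw [map_mul, ractR_mul])
    (fun c n => by rw [AlgHom.commutes, Algebra.algebraMap_eq_smul_one, map_smul, LinearMap.smul_apply, ractR_one])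
    (fun a b n => C.actR_ractR _ _ n) hΦ' (fun p k l => by
      obtain ⟨i, j⟩ := p
      have e1 : Φ (ω i j <• z q k l) = ∑ m, ∑ g, ∑ h, t • (z q k m • ω g h) ⊗ₜ[ℂ]
          ∑ d, ∑ e, ∑ a, ∑ b, (braid q ν d a e i * braid q ν j e b l) •
            (z q m d * (z q g a * antipodeZ q b h)) := by
        simp only [hω _ _ k l, map_sum, map_smul, hΦ', hw', comul_z, LinearMap.sum_apply,
          actR_tmul, TensorProduct.tmul_sum, TensorProduct.tmul_smul, Finset.smul_sum, smul_smul, mul_assoc]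
        simp only [← Fintype.sum_prod_type']
        refine Fintype.sum_equiv
          ⟨fun ⟨d, e, a, b, g, h, m⟩ => ⟨m, g, h, d, e, a, b⟩,
            fun ⟨m, g, h, d, e, a, b⟩ => ⟨d, e, a, b, g, h, m⟩, fun _ => rfl, fun _ => rfl⟩ _ _ ?_
        rintro ⟨d, e, a, b, g, h, m⟩
        simp only [Equiv.coe_fn_mk]
      have e2 : C.ractR (comul q (z q k l)) (Φ (ω i j)) = ∑ m, ∑ g, ∑ h, t • (z q k m • ω g h) ⊗ₜ[ℂ]
          ∑ n, ∑ a, ∑ b, ∑ e, (braid q ν m g e a * braid q ν b e h n) •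
            (z q a i * antipodeZ q j b * z q n l) := by
        simp only [hw', comul_z, map_sum, LinearMap.sum_apply, ractR_tmul, hω _ _ k _,
          TensorProduct.tmul_sum, TensorProduct.tmul_smul, TensorProduct.sum_tmul,
          ← TensorProduct.smul_tmul', Finset.smul_sum, smul_smul, mul_assoc]
        simp only [← Fintype.sum_prod_type']
        refine Fintype.sum_equiv
          ⟨fun ⟨a, b, n, m, e, g, h⟩ => ⟨m, g, h, n, a, b, e⟩,
            fun ⟨m, g, h, n, a, b, e⟩ => ⟨a, b, n, m, e, g, h⟩, fun _ => rfl, fun _ => rfl⟩ _ _ ?_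
        rintro ⟨a, b, n, m, e, g, h⟩
        simp only [Equiv.coe_fn_mk]
      exact (e1.trans (by simp only [braid_adjoint])).trans e2.symm)
  refine ⟨Φ, fun a b => ?_⟩
  have hT : Φ (∑ i, ω i i) = (∑ i, ω i i) ⊗ₜ 1 := by
    have e3 : Φ (∑ i, ω i i) = ∑ a, ∑ b, ω a b ⊗ₜ[ℂ] ∑ i, z q a i * antipodeZ q i b := by
      simp only [map_sum, hw', TensorProduct.tmul_sum]
      rw [Finset.sum_comm]
      refine Finset.sum_congr rfl fun a _ => Finset.sum_comm
    rw [e3]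
    simp only [sum_z_mul_antipodeZ, TensorProduct.sum_tmul]
    refine Finset.sum_congr rfl fun a _ => ?_
    rw [Finset.sum_eq_single a]
    · simp
    · intro b _ hb; simp [hb.symm]
    · simp
  rw [hΦ', hd, map_smul, map_sub, hr, hΦ', hT, map_d_id_of_inner hd]

theorem IsGamma.isBicovariant (h : C.IsGamma t ν) : C.IsBicovariant :=
  ⟨h.exists_left_coaction, h.exists_right_coaction⟩

end bicovariant
end FirstOrderCalculus

namespace FirstOrderCalculus
open GLq
variable {q : ℂ} [NeZero q] {t : ℂ} {C : FirstOrderCalculus (GLq q)}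

theorem IsGamma.isLeftBasis_dz {ν : Bool} (hs : q ^ 2 ≠ 1) (ht : t ≠ 0)
    (hc : traceCoeff q t ν ≠ 0) (h : C.IsGamma t ν) : C.IsLeftBasis C.dz := by
  obtain ⟨ω, hb, hω, hd⟩ := h
  exact hω.isBasisFamily_commutator_z hs ht hc hb hd

/-- The commutation relations of `Γ_ν(t)` in terms of `Tr_q θ`, for all indices at once. -/
theorem IsGamma.dz_mul_z {ν : Bool} (hs : q ^ 2 ≠ 1) (hc : traceCoeff q t ν ≠ 0)
    (h : C.IsGamma t ν) (i j k l : Fin 3) :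
    C.dz i j <• z q k l = (t - 1) • z q i j • C.dz k l +
      t • (diagCoeff q ν i k • (diagCoeff q ν l j • z q k l • C.dz i j
          + flipCoeff q ν j l • z q k j • C.dz i l)
        + flipCoeff q ν i k • (diagCoeff q ν l j • z q i l • C.dz k j
          + flipCoeff q ν j l • z q i j • C.dz k l))
      + (q / (q ^ 2 - 1) * (t - 1) / traceCoeff q t ν) • (z q i j * z q k l - t •
        (diagCoeff q ν i k • (diagCoeff q ν l j • (z q k l * z q i j)
          + flipCoeff q ν j l • (z q k j * z q i l))
        + flipCoeff q ν i k • (diagCoeff q ν l j • (z q i l * z q k j)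
          + flipCoeff q ν j l • (z q i j * z q k l)))) • C.trTheta := by
  obtain ⟨ω, hb, hω, hd⟩ := h
  have hq : q ≠ 0 := NeZero.ne q
  have hs' : q - q⁻¹ ≠ 0 := by
    intro h'; apply hs; field_simp at h'; simpa [sub_eq_zero] using h'
  have hs2 : q ^ 2 - 1 ≠ 0 := sub_ne_zero.2 hs
  have e : (q - q⁻¹)⁻¹ = q / (q ^ 2 - 1) := by
    rw [inv_eq_one_div, div_eq_div_iff hs' hs2]; field_simp
  have hT : C.trTheta = traceCoeff q t ν • ∑ i, ω i i := by
    rw [← qtrace_mcForm q t ν hs ω]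
    simp only [← hω.sum_antipodeZ_smul_commutator_z hs' hd]
    rfl
  rw [dz, hω.commutator_z_mul_z hs' hd, hT, e]
  congr 1
  rw [smul_comm _ (traceCoeff q t ν), smul_smul, div_mul_cancel₀ _ hc]

theorem IsGamma.relations1 (hs : q ^ 2 ≠ 1)
    (hN : q ^ 4 * (q ^ 2 + 1) * (t - 1) - q ^ 2 + t ≠ 0) (h : C.IsGamma t false) :
    C.Relations1 t := by
  have hq : q ≠ 0 := NeZero.ne q
  have hs2 : q ^ 2 - 1 ≠ 0 := sub_ne_zero.2 hs
  have hc : traceCoeff q t false ≠ 0 := div_ne_zero hN (mul_ne_zero hq hs2)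
  have key := h.dz_mul_z hs hc
  simp only [traceCoeff] at key
  obtain ⟨f, hf⟩ : ∃ f : GLq q → C.Form → C.Form, ∀ a m, a • m = f a m := ⟨_, fun _ _ => rfl⟩
  refine ⟨fun i j => ?_, fun i j l hjl => ?_, fun i j k hik => ?_, fun i j k l hik hjl => ?_,
    fun i j k l hik hlj => ?_⟩ <;> rw [key] <;> unfold sigma1 <;> try unfold beta1
  all_goals generalize q ^ 4 * (q ^ 2 + 1) * (t - 1) - q ^ 2 + t = N at hN
  · simp only [diagCoeff, flipCoeff_self, twist, if_true, zero_smul, add_zero, sub_smul, smul_assoc]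
    simp only [hf]
    match_scalars <;> field_simp
    ring
  · rw [z_row' q i j l hjl]
    simp only [diagCoeff, lt_self_iff_false, twist, if_true, zero_smul, add_zero, hjl.ne', if_false,
      flipCoeff, hjl.not_gt, sub_smul, smul_assoc]
    simp only [hf]
    match_scalars <;> field_simp
  · rw [z_col' q i k j hik]
    simp only [diagCoeff, lt_self_iff_false, twist, if_true, zero_smul, add_zero, hik.ne, if_false,
      flipCoeff, hik.not_gt, sub_smul, smul_assoc]
    simp only [hf]
    match_scalars <;> field_simp
  · rw [z_cross' q i j k l hik hjl]
    simp only [diagCoeff, zero_smul, add_zero, hik.ne, hjl.ne', if_false,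
      flipCoeff, hik.not_gt, hjl.not_gt, sub_smul, smul_sub, smul_assoc]
    simp only [hf]
    match_scalars <;> field_simp <;> ring
  · rw [← z_comm q i j k l hik hlj, z_cross' q i l k j hik hlj]
    simp only [diagCoeff, zero_smul, add_zero, hik.ne, hlj.ne, if_false, if_true, gap, twist,
      flipCoeff, hik.not_gt, hlj, sub_smul, add_smul, smul_sub, smul_assoc]
    simp only [hf]
    match_scalars <;> field_simp <;> ring

theorem IsGamma.relations2 (hs : q ^ 2 ≠ 1)
    (hN : q ^ 4 * (q ^ 2 * t - 1) + (q ^ 2 + 1) * (t - 1) ≠ 0) (h : C.IsGamma t true) :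
    C.Relations2 t := by
  have hq : q ≠ 0 := NeZero.ne q
  have hs2 : q ^ 2 - 1 ≠ 0 := sub_ne_zero.2 hs
  have hc : traceCoeff q t true ≠ 0 := div_ne_zero (mul_ne_zero hq hN) hs2
  have key := h.dz_mul_z hs hc
  simp only [traceCoeff] at key
  obtain ⟨f, hf⟩ : ∃ f : GLq q → C.Form → C.Form, ∀ a m, a • m = f a m := ⟨_, fun _ _ => rfl⟩
  refine ⟨fun i j => ?_, fun i j l hjl => ?_, fun i j k hik => ?_, fun i j k l hik hjl => ?_,
    fun i j k l hik hlj => ?_⟩ <;> rw [key] <;> unfold sigma2 <;> try unfold beta2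
  all_goals generalize q ^ 4 * (q ^ 2 * t - 1) + (q ^ 2 + 1) * (t - 1) = N at hN
  · simp only [diagCoeff, flipCoeff_self, twist, if_true, zero_smul, add_zero, sub_smul, smul_assoc]
    simp only [hf]
    match_scalars <;> field_simp <;> ring
  · rw [z_row' q i j l hjl]
    simp only [diagCoeff, lt_self_iff_false, twist, if_true, zero_smul, add_zero, hjl.ne', if_false,
      flipCoeff, hjl, gap, sub_smul, add_smul, smul_assoc]
    simp only [hf]
    match_scalars <;> field_simp <;> ring
  · rw [z_col' q i k j hik]
    simp only [diagCoeff, lt_self_iff_false, twist, if_true, zero_smul, add_zero, hik.ne, if_false,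
      flipCoeff, hik, gap, sub_smul, add_smul, smul_assoc]
    simp only [hf]
    match_scalars <;> field_simp <;> ring
  · rw [z_cross' q i j k l hik hjl, ← z_comm q i l k j hik hjl]
    simp only [diagCoeff, hik.ne, hjl.ne', if_false, if_true, gap, twist,
      flipCoeff, hik, hjl, sub_smul, add_smul, smul_sub, smul_assoc]
    simp only [hf]
    match_scalars <;> field_simp <;> ring
  · rw [← z_comm q i j k l hik hlj]
    simp only [diagCoeff, zero_smul, add_zero, hik.ne, hlj.ne, if_false, if_true, gap, twist,
      flipCoeff, hik, hlj.not_gt, sub_smul, add_smul, smul_sub, smul_assoc]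
    simp only [hf]
    match_scalars <;> field_simp <;> ring

/-- An expression in 1-forms that is, in every calculus with the property `P`, the same left
combination of the `d z^m_n`. -/
def HasCoeffs (P : FirstOrderCalculus (GLq q) → Prop)
    (X : ∀ C : FirstOrderCalculus (GLq q), C.Form) : Prop :=
  ∃ c : Fin 3 → Fin 3 → GLq q, ∀ C, P C → X C = ∑ m, ∑ n, c m n • C.dz m n

section coeffs
variable {P : FirstOrderCalculus (GLq q) → Prop} {X Y : ∀ C : FirstOrderCalculus (GLq q), C.Form}

theorem HasCoeffs.congr (h : HasCoeffs P Y) (e : ∀ C, P C → X C = Y C) : HasCoeffs P X := by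
  obtain ⟨c, hc⟩ := h
  exact ⟨c, fun C hC => (e C hC).trans (hc C hC)⟩

theorem HasCoeffs.add (h : HasCoeffs P X) (h' : HasCoeffs P Y) :
    HasCoeffs P fun C => X C + Y C := by
  obtain ⟨c, hc⟩ := h
  obtain ⟨c', hc'⟩ := h'
  exact ⟨fun m n => c m n + c' m n, fun C hC => by
    simp only [hc C hC, hc' C hC, add_smul, Finset.sum_add_distrib]⟩

theorem HasCoeffs.smul (h : HasCoeffs P X) (a : GLq q) : HasCoeffs P fun C => a • X C := by
  obtain ⟨c, hc⟩ := h
  exact ⟨fun m n => a * c m n, fun C hC => by simp only [hc C hC, mul_smul, Finset.smul_sum]⟩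

theorem HasCoeffs.csmul (h : HasCoeffs P X) (a : ℂ) : HasCoeffs P fun C => a • X C := by
  obtain ⟨c, hc⟩ := h
  exact ⟨fun m n => a • c m n, fun C hC => by simp only [hc C hC, smul_assoc, Finset.smul_sum]⟩

theorem HasCoeffs.sub (h : HasCoeffs P X) (h' : HasCoeffs P Y) :
    HasCoeffs P fun C => X C - Y C :=
  (h.add (h'.csmul (-1))).congr fun C _ => by rw [neg_one_smul, sub_eq_add_neg]

theorem hasCoeffs_dz (i j : Fin 3) : HasCoeffs P fun C => C.dz i j := by
  refine ⟨fun m n => if m = i ∧ n = j then 1 else 0, fun C _ => ?_⟩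
  simp only [ite_and]
  rw [Finset.sum_eq_single i, Finset.sum_eq_single j]
  · simp
  · intro b _ hb; simp [hb]
  · simp
  · intro b _ hb; simp [hb]
  · simp

theorem hasCoeffs_theta (i j : Fin 3) : HasCoeffs P fun C => C.theta i j := by
  simp only [theta, Fin.sum_univ_three]
  exact (((hasCoeffs_dz _ _).smul _).add ((hasCoeffs_dz _ _).smul _)).add ((hasCoeffs_dz _ _).smul _)

theorem hasCoeffs_trTheta : HasCoeffs P fun C => C.trTheta :=
  (((hasCoeffs_theta _ _).csmul _).add ((hasCoeffs_theta _ _).csmul _)).add (hasCoeffs_theta _ _)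

/-- The commutation relations for the pairs of generators in the ranges of the theorem determine
those for all pairs. -/
theorem hasCoeffs_of_ranges
    (same : ∀ i j, HasCoeffs P fun C => C.dz i j <• z q i j)
    (row : ∀ i j l, j < l → HasCoeffs P fun C => C.dz i j <• z q i l)
    (col : ∀ i j k, i < k → HasCoeffs P fun C => C.dz i j <• z q k j)
    (diag : ∀ i j k l, i < k → j < l → HasCoeffs P fun C => C.dz i j <• z q k l)
    (anti : ∀ i j k l, i < k → l < j → HasCoeffs P fun C => C.dz i j <• z q k l)
    (i j k l : Fin 3) : HasCoeffs P fun C => C.dz i j <• z q k l := by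
  have hq : q ≠ 0 := NeZero.ne q
  have leib : ∀ (C : FirstOrderCalculus (GLq q)) i j k l, C.d (z q i j * z q k l) =
      C.dz i j <• z q k l + z q i j • C.dz k l := fun C i j k l => C.leibniz _ _
  have anti' : ∀ i j k l, i < k → l < j → HasCoeffs P fun C => C.dz k l <• z q i j := by
    intro i j k l hik hlj
    refine (((anti i j k l hik hlj).add ((hasCoeffs_dz k l).smul (z q i j))).sub
      ((hasCoeffs_dz i j).smul (z q k l))).congr fun C _ => ?_
    rw [← leib, z_comm q i j k l hik hlj, leib, add_sub_cancel_right]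
  rcases lt_trichotomy i k with hik | rfl | hik <;> rcases lt_trichotomy j l with hjl | rfl | hjl
  · exact diag i j k l hik hjl
  · exact col i j k hik
  · exact anti i j k l hik hjl
  · exact row i j l hjl
  · exact same i j
  · refine ((((row i l j hjl).add ((hasCoeffs_dz i j).smul (z q i l))).csmul q⁻¹).sub
      ((hasCoeffs_dz i l).smul (z q i j))).congr fun C _ => ?_
    rw [← leib, ← map_smul, ← z_row' q i l j hjl, leib, add_sub_cancel_right]
  · exact anti' k l i j hik hjl
  · refine ((((col k j i hik).add ((hasCoeffs_dz i j).smul (z q k j))).csmul q⁻¹).sub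
      ((hasCoeffs_dz k j).smul (z q i j))).congr fun C _ => ?_
    rw [← leib, ← map_smul, ← z_col' q k i j hik, leib, add_sub_cancel_right]
  · refine ((((diag k l i j hik hjl).add ((hasCoeffs_dz i j).smul (z q k l))).sub
      (((anti k j i l hik hjl).add ((hasCoeffs_dz i l).smul (z q k j))).csmul (q - q⁻¹))).sub
      ((hasCoeffs_dz k l).smul (z q i j))).congr fun C _ => ?_
    rw [← leib, ← leib, ← map_smul, ← map_sub, ← z_cross' q k l i j hik hjl, leib, add_sub_cancel_right]

end coeffs

theorem Relations1.hasCoeffs (i j k l : Fin 3) :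
    HasCoeffs (q := q) (fun C => C.Relations1 t) fun C => C.dz i j <• z q k l := by
  refine hasCoeffs_of_ranges (fun i j => ?_) (fun i j l h => ?_) (fun i j k h => ?_)
    (fun i j k l h h' => ?_) (fun i j k l h h' => ?_) i j k l
  · exact HasCoeffs.congr ((((hasCoeffs_dz _ _).smul _).csmul _).add
      ((hasCoeffs_trTheta.smul _).csmul _)) fun C hC => hC.same i j
  · exact HasCoeffs.congr (((((hasCoeffs_dz _ _).smul _).csmul _).add
      (((hasCoeffs_dz _ _).smul _).csmul _)).add
      ((hasCoeffs_trTheta.smul _).csmul _)) fun C hC => hC.row i j l h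
  · exact HasCoeffs.congr (((((hasCoeffs_dz _ _).smul _).csmul _).add
      (((hasCoeffs_dz _ _).smul _).csmul _)).add
      ((hasCoeffs_trTheta.smul _).csmul _)) fun C hC => hC.col i j k h
  · exact HasCoeffs.congr ((((((hasCoeffs_dz _ _).smul _).csmul _).add
      (((hasCoeffs_dz _ _).smul _).csmul _)).add
      ((hasCoeffs_trTheta.smul _).csmul _)).sub ((hasCoeffs_trTheta.smul _).csmul _))
      fun C hC => hC.diag i j k l h h'
  · exact HasCoeffs.congr (((((((hasCoeffs_dz _ _).smul _).csmul _).add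
      (((hasCoeffs_dz _ _).smul _).csmul _)).add
      ((hasCoeffs_trTheta.smul _).csmul _)).sub (((hasCoeffs_dz _ _).smul _).csmul _)).add
      ((hasCoeffs_trTheta.smul _).csmul _))
      fun C hC => hC.anti i j k l h h'

theorem Relations2.hasCoeffs (i j k l : Fin 3) :
    HasCoeffs (q := q) (fun C => C.Relations2 t) fun C => C.dz i j <• z q k l := by
  refine hasCoeffs_of_ranges (fun i j => ?_) (fun i j l h => ?_) (fun i j k h => ?_)
    (fun i j k l h h' => ?_) (fun i j k l h h' => ?_) i j k l
  · exact HasCoeffs.congr ((((hasCoeffs_dz _ _).smul _).csmul _).add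
      ((hasCoeffs_trTheta.smul _).csmul _)) fun C hC => hC.same i j
  · exact HasCoeffs.congr (((((hasCoeffs_dz _ _).smul _).csmul _).add
      (((hasCoeffs_dz _ _).smul _).csmul _)).add
      ((hasCoeffs_trTheta.smul _).csmul _)) fun C hC => hC.row i j l h
  · exact HasCoeffs.congr (((((hasCoeffs_dz _ _).smul _).csmul _).add
      (((hasCoeffs_dz _ _).smul _).csmul _)).add
      ((hasCoeffs_trTheta.smul _).csmul _)) fun C hC => hC.col i j k h
  · exact HasCoeffs.congr ((((((((hasCoeffs_dz _ _).smul _).csmul _).add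
      (((hasCoeffs_dz _ _).smul _).csmul _)).add
      ((hasCoeffs_trTheta.smul _).csmul _)).add
      ((((hasCoeffs_dz _ _).smul _).add ((hasCoeffs_dz _ _).smul _)).csmul _)).add
      (((hasCoeffs_dz _ _).smul _).csmul _)).sub ((hasCoeffs_trTheta.smul _).csmul _))
      fun C hC => hC.diag i j k l h h'
  · exact HasCoeffs.congr (((((((hasCoeffs_dz _ _).smul _).csmul _).add
      (((hasCoeffs_dz _ _).smul _).csmul _)).add
      ((hasCoeffs_trTheta.smul _).csmul _)).add (((hasCoeffs_dz _ _).smul _).csmul _)).add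
      ((hasCoeffs_trTheta.smul _).csmul _))
      fun C hC => hC.anti i j k l h h'

/-- Two calculi in which the `d z^i_j` form left bases with the same commutation relations are
equivalent. -/
theorem equivalent_of_hasCoeffs {P : FirstOrderCalculus (GLq q) → Prop}
    (h : ∀ i j k l, HasCoeffs P fun C => C.dz i j <• z q k l) {C C' : FirstOrderCalculus (GLq q)}
    (hC : P C) (hC' : P C') (hb : C.IsLeftBasis C.dz) (hb' : C'.IsLeftBasis C'.dz) :
    C.Equivalent C' := by
  obtain ⟨ζ, hζ⟩ := exists_linearEquiv hb hb'
  have hζ' : ∀ i j, ζ (C.dz i j) = C'.dz i j := fun i j => hζ (i, j)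
  refine equivalent_of_generators ζ hb.2 (fun p k l => ?_) hζ'
  obtain ⟨c, hc⟩ := h p.1 p.2 k l
  have h1 := hc C hC
  have h2 := hc C' hC'
  simp only at h1 h2
  simp only [hζ', h1, h2, map_sum, map_smul]

theorem gamma_classification {ν : Bool} {P : FirstOrderCalculus (GLq q) → Prop}
    (hs : q ^ 2 ≠ 1) (ht : t ≠ 0) (hc : traceCoeff q t ν ≠ 0)
    (hP : ∀ C : FirstOrderCalculus (GLq q), C.IsGamma t ν → P C)
    (h : ∀ i j k l, HasCoeffs P fun C => C.dz i j <• z q k l) :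
    (∃ C : FirstOrderCalculus (GLq q), C.IsGamma t ν) ∧
    (∀ C C' : FirstOrderCalculus (GLq q), C.IsGamma t ν → C'.IsGamma t ν → C.Equivalent C') ∧
    (∀ C : FirstOrderCalculus (GLq q), C.IsGamma t ν → C.IsBicovariant) ∧
    (∀ C : FirstOrderCalculus (GLq q), C.IsGamma t ν ↔ C.IsLeftBasis C.dz ∧ P C) ∧
    (∃ c : Fin 3 → Fin 3 → Fin 3 → Fin 3 → Fin 3 → Fin 3 → GLq q,
      ∀ C : FirstOrderCalculus (GLq q), P C → ∀ i j k l : Fin 3,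
        C.dz i j <• z q k l = ∑ m, ∑ n, c i j k l m n • C.dz m n) := by
  have hs' : q - q⁻¹ ≠ 0 := by
    intro h'; apply hs; field_simp [NeZero.ne q] at h'; simpa [sub_eq_zero] using h'
  obtain ⟨C₀, hC₀⟩ := exists_isGamma hs ht hc
  refine ⟨⟨C₀, hC₀⟩, fun C C' hC hC' => hC.equivalent hs' hC', fun C hC => hC.isBicovariant,
    fun C => ⟨fun hC => ⟨hC.isLeftBasis_dz hs ht hc, hP C hC⟩, fun hC => ?_⟩, ?_⟩
  · exact (equivalent_of_hasCoeffs h (hP C₀ hC₀) hC.2 (hC₀.isLeftBasis_dz hs ht hc) hC.1).isGamma hC₀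
  · choose c hc using h
    exact ⟨c, fun C hC i j k l => hc i j k l C hC⟩

end FirstOrderCalculus

theorem mainTheorem2 (q : ℂ) [NeZero q] (hq1 : q ≠ 1) (hq2 : q ≠ -1)
    (hq3 : q ≠ Complex.I) (hq4 : q ≠ -Complex.I) :
    (∀ t : ℂ, t ≠ 0 → (q ^ 6 + q ^ 4 + 1) * t - (q ^ 6 + q ^ 4 + q ^ 2) ≠ 0 →
      (∃ C : FirstOrderCalculus (GLq q), C.IsGamma1 t) ∧
      (∀ C C' : FirstOrderCalculus (GLq q), C.IsGamma1 t → C'.IsGamma1 t → C.Equivalent C') ∧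
      (∀ C : FirstOrderCalculus (GLq q), C.IsGamma1 t → C.IsBicovariant) ∧
      (∀ C : FirstOrderCalculus (GLq q),
        C.IsGamma1 t ↔ C.IsLeftBasis C.dz ∧ C.Relations1 t) ∧
      (∃ c : Fin 3 → Fin 3 → Fin 3 → Fin 3 → Fin 3 → Fin 3 → GLq q,
        ∀ C : FirstOrderCalculus (GLq q), C.Relations1 t → ∀ i j k l : Fin 3,
          C.dz i j <• GLq.z q k l = ∑ m, ∑ n, c i j k l m n • C.dz m n)) ∧
    (∀ t : ℂ, t ≠ 0 → (q ^ 6 + q ^ 2 + 1) * t - (q ^ 4 + q ^ 2 + 1) ≠ 0 →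
      (∃ C : FirstOrderCalculus (GLq q), C.IsGamma2 t) ∧
      (∀ C C' : FirstOrderCalculus (GLq q), C.IsGamma2 t → C'.IsGamma2 t → C.Equivalent C') ∧
      (∀ C : FirstOrderCalculus (GLq q), C.IsGamma2 t → C.IsBicovariant) ∧
      (∀ C : FirstOrderCalculus (GLq q),
        C.IsGamma2 t ↔ C.IsLeftBasis C.dz ∧ C.Relations2 t) ∧
      (∃ c : Fin 3 → Fin 3 → Fin 3 → Fin 3 → Fin 3 → Fin 3 → GLq q,
        ∀ C : FirstOrderCalculus (GLq q), C.Relations2 t → ∀ i j k l : Fin 3,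
          C.dz i j <• GLq.z q k l = ∑ m, ∑ n, c i j k l m n • C.dz m n)) := by
  have hs : q ^ 2 ≠ 1 := fun h => (sq_eq_sq_iff_eq_or_eq_neg.1 (h.trans (one_pow 2).symm)).elim hq1 hq2
  refine ⟨fun t ht h => ?_, fun t ht h => ?_⟩
  · have hN : q ^ 4 * (q ^ 2 + 1) * (t - 1) - q ^ 2 + t ≠ 0 := fun h' => h (by linear_combination h')
    simp only [FirstOrderCalculus.isGamma1_iff]
    exact FirstOrderCalculus.gamma_classification hs ht
      (div_ne_zero hN (mul_ne_zero (NeZero.ne q) (sub_ne_zero.2 hs)))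
      (fun C hC => hC.relations1 hs hN) FirstOrderCalculus.Relations1.hasCoeffs
  · have hN : q ^ 4 * (q ^ 2 * t - 1) + (q ^ 2 + 1) * (t - 1) ≠ 0 :=
      fun h' => h (by linear_combination h')
    simp only [FirstOrderCalculus.isGamma2_iff]
    exact FirstOrderCalculus.gamma_classification hs ht
      (div_ne_zero (mul_ne_zero (NeZero.ne q) hN) (sub_ne_zero.2 hs))
      (fun C hC => hC.relations2 hs hN) FirstOrderCalculus.Relations2.hasCoeffs
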